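/- **Setting.** Let $S$ be a complete separable metric space and $M_1=M_1(S)$ the space of Borel probability measures on $S$. For a nonzero finite measure $\alpha$ on a measurable space $E$, let $\mathcal D(\alpha)$ be the law of a Dirichlet process with parameter $\alpha$, i.e. the law on $M_1(E)$ of a random probability measure $\lambda$ such that $(\lambda(B_0),\dots,\lambda(B_d))\sim\mathrm{Dir}(\alpha(B_0),\dots,\alpha(B_d))$ for every measurable partition $\{B_0,\dots,B_d\}$ of $E$. Let $\kappa,\varepsilon>0$ and $\varrho\in M_1$. Let $\xi=\{\xi_{ij}\}_{i,j\ge1}$ be a row exchangeable array of $S$-valued random variables, meaning that $\{\xi_{\sigma(i),\tau_i(j)}\}$ has the same finite-dimensional distributions as $\xi$ for all permutations $\sigma,\tau_1,\tau_2,\dots$ of the positive integers. Let $\mu_1,\mu_2,\dots$ be random elements of $M_1$ and $\varpi$ a random element of $M_1(M_1)$ such that 1. $\varpi\sim\mathcal D(\kappa\,\mathcal D(\varepsilon\varrho))$; 2. given $\varpi$, the sequence $\mu_1,\mu_2,\dots$ is i.i.d. with distribution $\varpi$; 3. for each $i$, given $\mu_i$, the sequence $\xi_{i1},\xi_{i2},\dots$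 is i.i.d. with distribution $\mu_i$. Fix $N$ and $m\ge1$. Put $X_{iN}=(\xi_{i1},\dots,\xi_{iN})$ and let $\varrho_N=\mathcal L(X_{mN})$. Let $T$ be a countable set, let $\varphi_1,\dots,\varphi_m:S^N\to T$ be measurable, and put $Y_i=\varphi_i(X_{iN})$, $\boldsymbol Y_m=(Y_1,\dots,Y_m)$ and $\boldsymbol\mu_{m-1}=(\mu_1,\dots,\mu_{m-1})$ (omitted if $m=1$). For $\boldsymbol y_m=(y_1,\dots,y_m)\in T^m$ and $\boldsymbol\nu_{m-1}=(\nu_1,\dots,\nu_{m-1})\in M_1^{m-1}$ let $A_m=\varphi_m^{-1}(\{y_m\})$ and $$q_i=\nu_i^N(A_m)\quad(1\le i<m),\qquad q_m=\kappa\,\varrho_N(A_m),\qquad p_i=\frac{q_i}{q_1+\cdots+q_m}.$$ **Theorem.** Consider the formula $$\gamma_m(\boldsymbol y_m,\boldsymbol\nu_{m-1})=p_m\int_{S^N}\mathcal D\Big(\varepsilon\varrho+\sum_{j=1}^N\delta_{x_j}\Big)\,\varrho_N(dx\mid A_m)+\sum_{i=1}^{m-1}p_i\,\delta_{\nu_i},\tag{$*$}$$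 where the first term is read as $0$ if $\varrho_N(A_m)=0$. (a) There is a probability kernel $\gamma_m$ from $T^m\times M_1^{m-1}$ to $M_1$ that is a regular conditional distribution of $\mu_m$ given $(\boldsymbol Y_m,\boldsymbol\mu_{m-1})$ and satisfies $(*)$ for all $(\boldsymbol y_m,\boldsymbol\nu_{m-1})$ with $q_1+\cdots+q_m>0$. (b) If $\gamma_m$ is any probability kernel from $T^m\times M_1^{m-1}$ to $M_1$ that is a regular conditional distribution of $\mu_m$ given $(\boldsymbol Y_m,\boldsymbol\mu_{m-1})$, then for almost every $(\boldsymbol y_m,\boldsymbol\nu_{m-1})$ with respect to the law of $(\boldsymbol Y_m,\boldsymbol\mu_{m-1})$ one has $q_1+\cdots+q_m>0$ and $(*)$ holds. -/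

import Mathlib

open MeasureTheory ProbabilityTheory
open scoped NNReal ENNReal

namespace NestedDirichlet

/-- The gamma distribution with shape `a` and rate `1`; for shape `0` it is, as usual in the
definition of the Dirichlet distribution, the point mass at `0`. -/
noncomputable def gammaLaw (a : ℝ) : Measure ℝ :=
  if a = 0 then Measure.dirac 0 else gammaMeasure a 1

/-- The Dirichlet distribution `Dir(a₀, …, a_d)`, where the `aᵢ ≥ 0` are not all zero, as a measure
on `ℝ^(d+1)` (concentrated on the simplex): the law of `(G₀, …, G_d) / (G₀ + ⋯ + G_d)`, where the
`Gᵢ` are independent and `Gᵢ` is gamma distributed with shape `aᵢ`. -/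
noncomputable def dirichletDistribution {d : ℕ} (a : Fin (d + 1) → ℝ) :
    Measure (Fin (d + 1) → ℝ) :=
  (Measure.pi fun i => gammaLaw (a i)).map fun g i => g i / ∑ j, g j

/-- `Q` is the law of a Dirichlet process with parameter `α`: if `ν` has distribution `Q` and
`B₀, …, B_d` is a measurable partition of `E`, then `(ν(B₀), …, ν(B_d))` has distribution
`Dir(α(B₀), …, α(B_d))`. -/
structure IsDirichletProcessLaw {E : Type*} [MeasurableSpace E] (α : Measure E)
    (Q : Measure (ProbabilityMeasure E)) : Prop where
  isProbabilityMeasure : IsProbabilityMeasure Q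
  map_eq : ∀ (d : ℕ) (B : Fin (d + 1) → Set E), (∀ i, MeasurableSet (B i)) →
    Pairwise (fun i j => Disjoint (B i) (B j)) → (⋃ i, B i) = Set.univ →
    Q.map (fun (ν : ProbabilityMeasure E) i => (ν : Measure E).real (B i)) =
      dirichletDistribution fun i => α.real (B i)

open Classical in
/-- `𝒟(α)`, the law of a Dirichlet process with parameter `α`, for a nonzero finite measure `α`.
It is the only measure with the finite-dimensional distributions required by
`IsDirichletProcessLaw α`. -/
noncomputable def dirichletLaw {E : Type*} [MeasurableSpace E] (α : Measure E) :
    Measure (ProbabilityMeasure E) :=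
  if h : ∃ Q, IsDirichletProcessLaw α Q then h.choose else 0

/-- Given the random probability measure `lam`, the sequence `η₀, η₁, …` is i.i.d. with
distribution `lam`. -/
def CondIID {Ω E : Type*} [MeasurableSpace Ω] [MeasurableSpace E] (P : Measure Ω)
    (η : ℕ → Ω → E) (lam : Ω → ProbabilityMeasure E) : Prop :=
  ∀ (n : ℕ) (B : Fin n → Set E), (∀ i, MeasurableSet (B i)) →
    P⟦⋂ i : Fin n, η i ⁻¹' B i | MeasurableSpace.comap lam inferInstance⟧
      =ᵐ[P] fun ω => ∏ i, (lam ω : Measure E).real (B i)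

/-- The array `ξ` is row exchangeable: for all permutations `σ` and `τ₀, τ₁, …` of `ℕ`, the arrays
`(ξ_{σ(i), τ_i(j)})` and `(ξ_{i, j})` have the same law on the product space (equivalently, the
same finite-dimensional distributions). -/
def RowExchangeable {Ω S : Type*} [MeasurableSpace Ω] [MeasurableSpace S] (P : Measure Ω)
    (ξ : ℕ → ℕ → Ω → S) : Prop :=
  ∀ (σ : Equiv.Perm ℕ) (τ : ℕ → Equiv.Perm ℕ),
    P.map (fun ω (i : ℕ) (j : ℕ) => ξ (σ i) (τ i j) ω) = P.map (fun ω (i : ℕ) (j : ℕ) => ξ i j ω)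

/-- `ξ` is an array of samples from the nested Dirichlet process `ϖ` with column concentration `κ`,
row concentration `ε` and base measure `ϱ`, and `μ₀, μ₁, …` are its row distributions. Rows and
columns are numbered from `0`. -/
structure IsNDPArray {Ω S : Type*} [MeasurableSpace Ω] [MeasurableSpace S] (P : Measure Ω)
    (κ ε : ℝ≥0) (ϱ : ProbabilityMeasure S) (ϖ : Ω → ProbabilityMeasure (ProbabilityMeasure S))
    (μ : ℕ → Ω → ProbabilityMeasure S) (ξ : ℕ → ℕ → Ω → S) : Prop where
  measurable_generator : Measurable ϖ
  measurable_rowDist : ∀ i, Measurable (μ i)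
  measurable_array : ∀ i j, Measurable (ξ i j)
  rowExchangeable : RowExchangeable P ξ
  /-- `ϖ ∼ 𝒟(κ 𝒟(ε ϱ))` -/
  law_generator : P.map ϖ = dirichletLaw (κ • dirichletLaw (ε • (ϱ : Measure S)))
  /-- given `ϖ`, the `μ i` are i.i.d. with distribution `ϖ` -/
  rowDist_iid : CondIID P μ ϖ
  /-- given `μ i`, the entries of row `i` are i.i.d. with distribution `μ i` -/
  row_iid : ∀ i, CondIID P (ξ i) (μ i)

/-- The first `N` entries of row `i` of the array `ξ`. -/
def rowSample {Ω S : Type*} (ξ : ℕ → ℕ → Ω → S) (N i : ℕ) (ω : Ω) : Fin N → S :=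
  fun j => ξ i j ω

/-- The numbers `q`: `q_i = ν_i^N(A)` for the `m` previous rows `i`, and `κ ϱ_N(A)` for the
current row, which comes last. -/
noncomputable def rowWeight {S : Type*} [MeasurableSpace S] {m N : ℕ} (κ : ℝ≥0)
    (ϱN : Measure (Fin N → S)) (A : Set (Fin N → S)) (ν : Fin m → ProbabilityMeasure S) :
    Fin (m + 1) → ℝ≥0∞ :=
  Fin.snoc (α := fun _ => ℝ≥0∞)
    (fun i => Measure.pi (fun _ : Fin N => (ν i : Measure S)) A) ((κ : ℝ≥0∞) * ϱN A)

/-- The measure `p_m ∫ 𝒟(ε ϱ + ∑ⱼ δ_{xⱼ}) ϱ_N(dx | A) + ∑ᵢ p_i δ_{ν_i}`, where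
`p_i = q_i / (q_1 + ⋯ + q_m)`. -/
noncomputable def singleRowLaw {S : Type*} [MeasurableSpace S] {m N : ℕ} (κ ε : ℝ≥0)
    (ϱ : ProbabilityMeasure S) (ϱN : Measure (Fin N → S)) (A : Set (Fin N → S))
    (ν : Fin m → ProbabilityMeasure S) : Measure (ProbabilityMeasure S) :=
  let q := rowWeight κ ϱN A ν
  let p : Fin (m + 1) → ℝ≥0∞ := fun i => q i / ∑ j, q j
  p (Fin.last m) •
      (ϱN[|A]).bind (fun x => dirichletLaw (ε • (ϱ : Measure S) + ∑ j, Measure.dirac (x j)))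
    + ∑ i : Fin m, p i.castSucc • Measure.dirac (ν i)

end NestedDirichlet

open NestedDirichlet

/-!
The sum and the normalization of independent gamma variables are independent; this makes the
Dirichlet process conjugate to sampling: after draws `x₁, …, x_N` the posterior of `𝒟(α)` is
`𝒟(α + ∑ δ_{x_j})`. Applied one level up it gives the Pólya urn, in which `μ_m` given
`μ_1, …, μ_{m-1}` has law proportional to `κ 𝒟(ερ) + ∑ δ_{μ_i}`.

By the strong law of large numbers a row of the array determines its directing measure, and row
exchangeability then makes the rows conditionally independent given all the directing measures.
Hence the data of the earlier rows add nothing to `μ_1, …, μ_{m-1}`, and Bayes' formula for the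
remaining observation tilts the urn by the likelihood `ν ↦ ν^N(A_m)`: an atom at `μ_i` receives
weight `μ_i^N(A_m)`, while the continuous part becomes a mixture of Dirichlet posteriors.
-/

namespace NestedDirichlet

/-! ### Laplace transforms -/

theorem Iio_subset_interior_integrableExpSet {μ : Measure ℝ} {b : ℝ}
    (h : ∀ t < b, ∫⁻ x, ENNReal.ofReal (Real.exp (t * x)) ∂μ ≠ ∞) :
    Set.Iio b ⊆ interior (integrableExpSet id μ) := by
  refine interior_maximal (fun t ht => ⟨by fun_prop, ?_⟩) isOpen_Iio
  rw [hasFiniteIntegral_iff_ofReal (Filter.Eventually.of_forall fun x => (Real.exp_pos _).le)]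
  exact (h t ht).lt_top

theorem eqOn_complexMGF_of_eqOn_mgf {μ ν : Measure ℝ} {b : ℝ}
    (hμ : Set.Iio b ⊆ interior (integrableExpSet id μ))
    (hν : Set.Iio b ⊆ interior (integrableExpSet id ν))
    (h : Set.EqOn (mgf id μ) (mgf id ν) (Set.Iio b)) :
    Set.EqOn (complexMGF id μ) (complexMGF id ν) {z | z.re < b} := by
  refine AnalyticOnNhd.eqOn_of_preconnected_of_frequently_eq
    (analyticOnNhd_complexMGF.mono fun z hz => hμ hz)
    (analyticOnNhd_complexMGF.mono fun z hz => hν hz)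
    ((convex_Iio b).linear_preimage Complex.reLm).isPreconnected
    (z₀ := ((b - 1 : ℝ) : ℂ)) (by simp) ?_
  have hreal : ∃ᶠ x : ℝ in nhdsWithin (b - 1) {b - 1}ᶜ,
      complexMGF id μ x = complexMGF id ν x := by
    refine Filter.Eventually.frequently ?_
    filter_upwards [nhdsWithin_le_nhds (Iio_mem_nhds (sub_one_lt b))] with x hx
    rw [complexMGF_ofReal, complexMGF_ofReal, h hx]
  refine Filter.Tendsto.frequently (f := ((↑) : ℝ → ℂ)) ?_ hreal
  exact tendsto_nhdsWithin_of_tendsto_nhds_of_eventually_within _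
    (Complex.continuous_ofReal.continuousWithinAt.tendsto)
    (eventually_nhdsWithin_of_forall fun x hx => by simpa [Complex.ext_iff] using hx)

theorem ext_of_lintegral_exp_eq {μ ν : Measure ℝ} [IsFiniteMeasure μ] [IsFiniteMeasure ν] {b : ℝ}
    (hb : 0 < b) (hμ : ∀ t < b, ∫⁻ x, ENNReal.ofReal (Real.exp (t * x)) ∂μ ≠ ∞)
    (h : ∀ t < b, ∫⁻ x, ENNReal.ofReal (Real.exp (t * x)) ∂μ =
      ∫⁻ x, ENNReal.ofReal (Real.exp (t * x)) ∂ν) : μ = ν := by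
  have hmgf (ρ : Measure ℝ) (t : ℝ) :
      mgf id ρ t = (∫⁻ x, ENNReal.ofReal (Real.exp (t * x)) ∂ρ).toReal :=
    integral_eq_lintegral_of_nonneg_ae (.of_forall fun x => (Real.exp_pos _).le) (by fun_prop)
  have heq : Set.EqOn (complexMGF id μ) (complexMGF id ν) {z | z.re < b} :=
    eqOn_complexMGF_of_eqOn_mgf (Iio_subset_interior_integrableExpSet hμ)
      (Iio_subset_interior_integrableExpSet fun t ht => h t ht ▸ hμ t ht)
      fun t ht => by rw [hmgf, hmgf, h t ht]
  refine Measure.ext_of_charFun (funext fun t => ?_)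
  rw [← complexMGF_id_mul_I, ← complexMGF_id_mul_I]
  exact heq (by simpa using hb)

/-! ### Finite products of probability measures -/

section Pi

variable {ι : Type*} [Fintype ι] {X : ι → Type*} [∀ i, MeasurableSpace (X i)]
  (μ : ∀ i, Measure (X i)) [∀ i, IsProbabilityMeasure (μ i)]

theorem lintegral_pi_prod {f : ∀ i, X i → ℝ≥0∞} (hf : ∀ i, Measurable (f i)) :
    ∫⁻ x, ∏ i, f i (x i) ∂Measure.pi μ = ∏ i, ∫⁻ x, f i x ∂μ i := by
  rw [lintegral_prod_eq_prod_lintegral_of_indepFun Finset.univ (fun i (x : ∀ i, X i) => f i (x i))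
    (iIndepFun_pi fun i => (hf i).aemeasurable) fun i => (hf i).comp (measurable_pi_apply i)]
  exact Finset.prod_congr rfl fun i _ => (measurePreserving_eval μ i).lintegral_comp (hf i)

theorem pi_withDensity {f : ∀ i, X i → ℝ≥0∞} (hf : ∀ i, Measurable (f i))
    [∀ i, SigmaFinite ((μ i).withDensity (f i))] :
    Measure.pi (fun i => (μ i).withDensity (f i)) =
      (Measure.pi μ).withDensity fun x => ∏ i, f i (x i) := by
  classical
  refine Measure.pi_eq fun s hs => ?_
  rw [withDensity_apply _ (.univ_pi hs), ← lintegral_indicator (.univ_pi hs)]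
  simp_rw [withDensity_apply _ (hs _), ← lintegral_indicator (hs _)]
  rw [← lintegral_pi_prod μ fun i => (hf i).indicator (hs i)]
  congr with x
  simp only [Set.indicator_apply, Set.mem_univ_pi, Finset.prod_ite_zero, Finset.mem_univ,
    true_implies]

theorem pi_smul_measure (c : ι → ℝ≥0∞) (hc : ∀ i, c i ≠ ∞) :
    Measure.pi (fun i => c i • μ i) = (∏ i, c i) • Measure.pi μ := by
  have (i : ι) : IsFiniteMeasure (c i • μ i) := Measure.smul_finite _ (hc i)
  refine Measure.pi_eq fun s _ => ?_
  simp [Finset.prod_mul_distrib]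

end Pi

/-! ### Gamma distributions -/

theorem gammaMeasure_withDensity_exp {a r t : ℝ} (ha : 0 < a) (hr : 0 < r) (ht : t < r) :
    (gammaMeasure a r).withDensity (fun x => ENNReal.ofReal (Real.exp (t * x))) =
      ENNReal.ofReal ((r / (r - t)) ^ a) • gammaMeasure a (r - t) := by
  have hrt : 0 < r - t := sub_pos.2 ht
  rw [gammaMeasure, gammaMeasure, ← withDensity_mul _ (by unfold gammaPDF; fun_prop) (by fun_prop),
    ← withDensity_smul _ (by unfold gammaPDF; fun_prop)]
  refine congrArg _ (funext fun x => ?_)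
  rw [Pi.mul_apply, Pi.smul_apply, smul_eq_mul]
  rcases lt_or_ge x 0 with hx | hx
  · simp [gammaPDF_of_neg hx]
  rw [gammaPDF_of_nonneg hx, gammaPDF_of_nonneg hx, ← ENNReal.ofReal_mul (by positivity),
    ← ENNReal.ofReal_mul (by positivity), mul_assoc _ (Real.exp _), ← Real.exp_add,
    Real.div_rpow hr.le hrt.le]
  congr 1
  field_simp
  ring_nf

theorem gammaPDF_div {a r c x : ℝ} (hr : 0 ≤ r) (hc : 0 < c) :
    ENNReal.ofReal c * gammaPDF a (r / c) (c * x) = gammaPDF a r x := by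
  rcases lt_or_ge x 0 with hx | hx
  · rw [gammaPDF_of_neg hx, gammaPDF_of_neg (mul_neg_of_pos_of_neg hc hx), mul_zero]
  rw [gammaPDF_of_nonneg hx, gammaPDF_of_nonneg (by positivity), ← ENNReal.ofReal_mul hc.le,
    Real.div_rpow hr hc.le, Real.mul_rpow hc.le hx, Real.rpow_sub_one hc.ne', ← mul_assoc (r / c),
    div_mul_cancel₀ _ hc.ne']
  congr 1
  have := (Real.rpow_pos_of_pos hc a).ne'
  field_simp

theorem gammaMeasure_map_mul {a r c : ℝ} (hr : 0 ≤ r) (hc : 0 < c) :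
    (gammaMeasure a r).map (fun x => c * x) = gammaMeasure a (r / c) := by
  ext s hs
  have hpdf (r : ℝ) : Measurable (gammaPDF a r) := by unfold gammaPDF; fun_prop
  rw [Measure.map_apply (by fun_prop) hs, gammaMeasure, gammaMeasure, withDensity_apply _ hs,
    withDensity_apply _ (measurable_const_mul c hs)]
  nth_rewrite 2 [← Real.smul_map_volume_mul_left hc.ne']
  rw [Measure.restrict_smul, lintegral_smul_measure,
    Measure.restrict_map (measurable_const_mul c) hs,
    lintegral_map (hpdf _) (measurable_const_mul c), abs_of_pos hc, smul_eq_mul,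
    ← lintegral_const_mul _ ((hpdf _).fun_comp (measurable_const_mul c))]
  simp_rw [gammaPDF_div hr hc]

theorem gammaLaw_of_pos {a : ℝ} (ha : 0 < a) : gammaLaw a = gammaMeasure a 1 := if_neg ha.ne'

theorem gammaLaw_zero : gammaLaw 0 = Measure.dirac 0 := if_pos rfl

instance isProbabilityMeasure_gammaLaw (a : ℝ≥0) : IsProbabilityMeasure (gammaLaw a) := by
  rcases eq_zero_or_pos a with rfl | ha
  · rw [NNReal.coe_zero, gammaLaw_zero]
    infer_instance
  · rw [gammaLaw_of_pos (by exact_mod_cast ha)]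
    exact isProbabilityMeasure_gammaMeasure (by exact_mod_cast ha) one_pos

theorem ae_gammaLaw_pos {a : ℝ} (ha : 0 < a) : ∀ᵐ x ∂gammaLaw a, 0 < x := by
  rw [gammaLaw_of_pos ha, gammaMeasure, ae_withDensity_iff (by unfold gammaPDF; fun_prop)]
  filter_upwards [Measure.ae_ne volume 0] with x hx hpdf
  by_contra hneg
  exact hpdf (gammaPDF_of_neg (lt_of_le_of_ne (not_lt.mp hneg) hx))

theorem gammaLaw_withDensity_id (a : ℝ≥0) :
    (gammaLaw a).withDensity (fun x => ENNReal.ofReal x) = (a : ℝ≥0∞) • gammaLaw (a + 1 : ℝ≥0) := by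
  rcases eq_zero_or_pos a with rfl | ha
  · simp [gammaLaw_zero, dirac_withDensity]
  have ha' : (0 : ℝ) < a := by exact_mod_cast ha
  rw [gammaLaw_of_pos ha', gammaLaw_of_pos (by positivity), gammaMeasure, gammaMeasure,
    ← withDensity_mul _ (by unfold gammaPDF; fun_prop) (by fun_prop),
    ← withDensity_smul _ (by unfold gammaPDF; fun_prop)]
  refine congrArg _ (funext fun x => ?_)
  rw [Pi.mul_apply, Pi.smul_apply, smul_eq_mul]
  rcases lt_or_ge x 0 with hx | hx
  · simp [gammaPDF_of_neg hx]
  rw [gammaPDF_of_nonneg hx, gammaPDF_of_nonneg hx, ← ENNReal.ofReal_mul (by positivity),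
    ← ENNReal.ofReal_coe_nnreal, ← ENNReal.ofReal_mul (by positivity), NNReal.coe_add,
    NNReal.coe_one, Real.Gamma_add_one ha'.ne']
  congr 1
  rcases hx.eq_or_lt with rfl | hx
  · simp [Real.zero_rpow ha'.ne']
  rw [add_sub_cancel_right, Real.rpow_sub_one hx.ne', Real.one_rpow, Real.one_rpow]
  field_simp

theorem lintegral_id_gammaLaw (a : ℝ≥0) : ∫⁻ x, ENNReal.ofReal x ∂gammaLaw a = a := by
  simpa [-NNReal.coe_add] using congrArg (fun ρ => ρ Set.univ) (gammaLaw_withDensity_id a)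

theorem gammaLaw_withDensity_exp (a : ℝ≥0) {t : ℝ} (ht : t < 1) :
    (gammaLaw a).withDensity (fun x => ENNReal.ofReal (Real.exp (t * x))) =
      ENNReal.ofReal ((1 - t) ^ (-(a : ℝ))) • (gammaLaw a).map fun x => (1 - t)⁻¹ * x := by
  have hr : 0 < 1 - t := sub_pos.2 ht
  rcases eq_zero_or_pos a with rfl | ha
  · simp [gammaLaw_zero, dirac_withDensity, Measure.map_dirac]
  have ha' : (0 : ℝ) < a := by exact_mod_cast ha
  rw [gammaLaw_of_pos ha', gammaMeasure_withDensity_exp ha' one_pos ht,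
    gammaMeasure_map_mul zero_le_one (inv_pos.2 hr), one_div, one_div, inv_inv,
    Real.inv_rpow hr.le, Real.rpow_neg hr.le]

theorem lintegral_exp_gammaLaw (a : ℝ≥0) {t : ℝ} (ht : t < 1) :
    ∫⁻ x, ENNReal.ofReal (Real.exp (t * x)) ∂gammaLaw a =
      ENNReal.ofReal ((1 - t) ^ (-(a : ℝ))) := by
  have := congrArg (fun ρ => ρ Set.univ) (gammaLaw_withDensity_exp a ht)
  simpa only [withDensity_apply _ MeasurableSet.univ, Measure.restrict_univ, Measure.smul_apply,
    smul_eq_mul, Measure.map_apply (measurable_const_mul _) MeasurableSet.univ, Set.preimage_univ,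
    measure_univ, mul_one] using this

/-! ### Gamma and Dirichlet vectors -/

section GammaVec

variable {ι : Type*} [Fintype ι] (a : ι → ℝ≥0)

/-- The law of a vector of independent gamma variables with rate `1` and shapes `a`. -/
noncomputable def gammaVec : Measure (ι → ℝ) := Measure.pi fun i => gammaLaw (a i)

/-- The vector `g` divided by the sum of its entries, a point of the simplex; it is the zero vector
when the entries sum to `0`. -/
noncomputable def normalize (g : ι → ℝ) : ι → ℝ := fun i => g i / ∑ j, g j

instance : IsProbabilityMeasure (gammaVec a) := by
  unfold gammaVec
  infer_instance

@[fun_prop]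
theorem measurable_normalize : Measurable (normalize : (ι → ℝ) → ι → ℝ) := by
  unfold normalize
  fun_prop

instance : IsProbabilityMeasure ((gammaVec a).map normalize) :=
  Measure.isProbabilityMeasure_map (by fun_prop)

theorem normalize_smul {r : ℝ} (hr : r ≠ 0) (g : ι → ℝ) : normalize (r • g) = normalize g := by
  ext i
  simp only [normalize, Pi.smul_apply, smul_eq_mul, ← Finset.mul_sum]
  exact mul_div_mul_left _ _ hr

theorem gammaVec_withDensity_exp {t : ℝ} (ht : t < 1) :
    (gammaVec a).withDensity (fun g => ENNReal.ofReal (Real.exp (t * ∑ i, g i))) =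
      ENNReal.ofReal ((1 - t) ^ (-((∑ i, a i : ℝ≥0) : ℝ))) •
        (gammaVec a).map fun g => (1 - t)⁻¹ • g := by
  have hexp (g : ι → ℝ) : ENNReal.ofReal (Real.exp (t * ∑ i, g i)) =
      ∏ i, ENNReal.ofReal (Real.exp (t * g i)) := by
    rw [← ENNReal.ofReal_prod_of_nonneg fun i _ => (Real.exp_pos _).le, ← Real.exp_sum,
      Finset.mul_sum]
  have (i : ι) : IsProbabilityMeasure ((gammaLaw (a i)).map fun x => (1 - t)⁻¹ * x) :=
    Measure.isProbabilityMeasure_map (by fun_prop)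
  have (i : ι) : SigmaFinite ((gammaLaw (a i)).withDensity
      fun x => ENNReal.ofReal (Real.exp (t * x))) := by
    have := Measure.smul_finite ((gammaLaw (a i)).map fun x => (1 - t)⁻¹ * x)
      (ENNReal.ofReal_ne_top (r := (1 - t) ^ (-(a i : ℝ))))
    rw [gammaLaw_withDensity_exp _ ht]
    infer_instance
  simp_rw [hexp]
  rw [gammaVec, ← pi_withDensity _ (f := fun _ x => ENNReal.ofReal (Real.exp (t * x)))
    (by fun_prop)]
  simp_rw [gammaLaw_withDensity_exp _ ht]
  rw [pi_smul_measure _ _ fun i => ENNReal.ofReal_ne_top,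
    ← Measure.pi_map_pi (fun i => by fun_prop),
    ← ENNReal.ofReal_prod_of_nonneg fun i _ => by
      have := sub_pos.2 ht
      positivity,
    ← Real.rpow_sum_of_pos (sub_pos.2 ht), Finset.sum_neg_distrib, NNReal.coe_sum]
  rfl

/- Tilting by `exp (t * ∑ i, g i)` only rescales the gamma vector, which leaves the normalized
vector unchanged; so the sum has the same Laplace transform on every event of the latter. -/
theorem map_sum_restrict_gammaVec {D : Set (ι → ℝ)} (hD : MeasurableSet D) :
    ((gammaVec a).restrict (normalize ⁻¹' D)).map (fun g => ∑ i, g i) =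
      gammaVec a (normalize ⁻¹' D) • gammaLaw (∑ i, a i : ℝ≥0) := by
  have hD' : MeasurableSet (normalize ⁻¹' D) := measurable_normalize hD
  have hfin : gammaVec a (normalize ⁻¹' D) ≠ ∞ := measure_ne_top _ _
  have := Measure.smul_finite (gammaLaw (∑ i, a i : ℝ≥0)) hfin
  have hL : ∀ t < (1 : ℝ), ∫⁻ x, ENNReal.ofReal (Real.exp (t * x))
      ∂((gammaVec a).restrict (normalize ⁻¹' D)).map (fun g => ∑ i, g i) =
        gammaVec a (normalize ⁻¹' D) *
          ENNReal.ofReal ((1 - t) ^ (-((∑ i, a i : ℝ≥0) : ℝ))) := by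
    intro t ht
    have hr : (1 - t)⁻¹ ≠ 0 := inv_ne_zero (by linarith)
    rw [lintegral_map (by fun_prop) (by fun_prop), ← withDensity_apply _ hD',
      gammaVec_withDensity_exp a ht, Measure.smul_apply, Measure.map_apply (by fun_prop) hD',
      smul_eq_mul, mul_comm]
    simp only [Set.preimage_preimage, normalize_smul hr]
  refine ext_of_lintegral_exp_eq one_pos (fun t ht => ?_) fun t ht => ?_
  · rw [hL t ht]
    exact ENNReal.mul_ne_top hfin ENNReal.ofReal_ne_top
  · rw [hL t ht, lintegral_smul_measure, lintegral_exp_gammaLaw _ ht, smul_eq_mul]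

theorem gammaVec_map_sum_normalize :
    (gammaVec a).map (fun g => (∑ i, g i, normalize g)) =
      (gammaLaw (∑ i, a i : ℝ≥0)).prod ((gammaVec a).map normalize) := by
  refine (Measure.prod_eq fun s D hs hD => ?_).symm
  have hsum : Measurable fun g : ι → ℝ => ∑ i, g i := by fun_prop
  have key := congrArg (fun ρ => ρ s) (map_sum_restrict_gammaVec a hD)
  simp only [Measure.map_apply hsum hs, Measure.restrict_apply (hsum hs), Measure.smul_apply,
    smul_eq_mul] at key
  rw [Measure.map_apply (by fun_prop) (hs.prod hD), Measure.map_apply (by fun_prop) hD, mul_comm,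
    ← key]
  rfl

theorem gammaVec_map_sum : (gammaVec a).map (fun g => ∑ i, g i) = gammaLaw (∑ i, a i : ℝ≥0) := by
  have := congrArg Measure.fst (gammaVec_map_sum_normalize a)
  rwa [Measure.fst_map_prodMk (by fun_prop), Measure.fst_prod] at this

theorem ae_gammaVec_sum_pos (ha : 0 < ∑ i, a i) : ∀ᵐ g ∂gammaVec a, 0 < ∑ i, g i := by
  have := ae_gammaLaw_pos (a := (∑ i, a i : ℝ≥0)) (by exact_mod_cast ha)
  rw [← gammaVec_map_sum] at this
  exact ae_of_ae_map (by fun_prop) this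

theorem prod_map_smul_normalize (ha : 0 < ∑ i, a i) :
    ((gammaLaw (∑ i, a i : ℝ≥0)).prod ((gammaVec a).map normalize)).map (fun p => p.1 • p.2) =
      gammaVec a := by
  rw [← gammaVec_map_sum_normalize, Measure.map_map (by fun_prop) (by fun_prop)]
  conv_rhs => rw [← Measure.map_id (μ := gammaVec a)]
  refine Measure.map_congr ?_
  filter_upwards [ae_gammaVec_sum_pos a ha] with g hg
  ext i
  exact mul_div_cancel₀ _ hg.ne'

theorem gammaLaw_conv (a b : ℝ≥0) : (gammaLaw a).conv (gammaLaw b) = gammaLaw (a + b : ℝ≥0) := by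
  have hsum := gammaVec_map_sum ![a, b]
  have hpair := (measurePreserving_piFinTwo (fun i => gammaLaw (![a, b] i))).map_eq
  rw [Fin.sum_univ_two] at hsum
  simp only [Matrix.cons_val_zero, Matrix.cons_val_one] at hsum hpair
  rw [← hsum, Measure.conv, ← hpair, Measure.map_map (by fun_prop) (by fun_prop)]
  refine congrArg (fun f => Measure.map f _) (funext fun g => ?_)
  simp [Fin.sum_univ_two]

theorem gammaVec_conv (b : ι → ℝ≥0) : (gammaVec a).conv (gammaVec b) = gammaVec (a + b) := by
  have (i : ι) : SigmaFinite (((gammaLaw (a i)).prod (gammaLaw (b i))).map fun p => p.1 + p.2) := by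
    have := gammaLaw_conv (a i) (b i)
    rw [Measure.conv] at this
    rw [this]
    infer_instance
  have hpair := measurePreserving_arrowProdEquivProdArrow ℝ ℝ ι (fun i => gammaLaw (a i))
    fun i => gammaLaw (b i)
  calc (gammaVec a).conv (gammaVec b)
      = (Measure.pi fun i => (gammaLaw (a i)).prod (gammaLaw (b i))).map
          fun g i => (g i).1 + (g i).2 := by
        rw [Measure.conv, gammaVec, gammaVec, ← hpair.map_eq,
          Measure.map_map (by fun_prop) hpair.measurable]
        rfl
    _ = Measure.pi fun i => (gammaLaw (a i)).conv (gammaLaw (b i)) :=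
        Measure.pi_map_pi (μ := fun i => (gammaLaw (a i)).prod (gammaLaw (b i)))
          (f := fun _ p => p.1 + p.2) fun i => by fun_prop
    _ = gammaVec (a + b) := by simp only [gammaLaw_conv, gammaVec, Pi.add_apply]

omit [Fintype ι] in
theorem measurable_piSingle [DecidableEq ι] (k : ι) :
    Measurable (Pi.single (M := fun _ : ι => ℝ) k) :=
  measurable_pi_lambda _ fun i => by
    simp only [Pi.single_apply]
    split_ifs <;> fun_prop

theorem gammaVec_single [DecidableEq ι] (k : ι) (b : ℝ≥0) :
    gammaVec (Pi.single k b) = (gammaLaw b).map (Pi.single (M := fun _ : ι => ℝ) k) := by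
  have hcoord (i : ι) : (gammaLaw b).map (fun x => (Pi.single k x : ι → ℝ) i) =
      gammaLaw ((Pi.single k b : ι → ℝ≥0) i) := by
    rcases eq_or_ne i k with rfl | h
    · simp
    · simp [h, gammaLaw_zero]
  have (i : ι) : SigmaFinite ((gammaLaw b).map fun x => (Pi.single k x : ι → ℝ) i) := by
    rw [hcoord]
    infer_instance
  calc gammaVec (Pi.single k b)
      = (Measure.pi fun _ => gammaLaw b).map fun g i => (Pi.single k (g i) : ι → ℝ) i := by
        rw [Measure.pi_map_pi (f := fun i x => (Pi.single k x : ι → ℝ) i) fun i =>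
          ((measurable_pi_apply i).comp (measurable_piSingle k)).aemeasurable]
        simp only [hcoord, gammaVec]
    _ = ((Measure.pi fun _ : ι => gammaLaw b).map (Function.eval k)).map (Pi.single k) := by
        rw [Measure.map_map (measurable_piSingle k) (measurable_pi_apply k)]
        refine congrArg (fun f => Measure.map f _) (funext fun g => funext fun i => ?_)
        rcases eq_or_ne i k with rfl | h
        · simp
        · simp [h]
    _ = (gammaLaw b).map (Pi.single k) := by
        rw [(measurePreserving_eval (fun _ : ι => gammaLaw b) k).map_eq]

theorem gammaVec_zero [Nonempty ι] : gammaVec (0 : ι → ℝ≥0) = Measure.dirac 0 := by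
  classical
  rw [← Pi.single_zero (Classical.arbitrary ι), gammaVec_single, NNReal.coe_zero, gammaLaw_zero,
    Measure.map_dirac' (measurable_piSingle _), Pi.single_zero]

theorem gammaVec_withDensity_apply [DecidableEq ι] (k : ι) :
    (gammaVec a).withDensity (fun g => ENNReal.ofReal (g k)) =
      (a k : ℝ≥0∞) • gammaVec (a + Pi.single k 1) := by
  have hprod (g : ι → ℝ) : ENNReal.ofReal (g k) =
      ∏ i, if i = k then ENNReal.ofReal (g i) else 1 := by simp
  have hbias (i : ι) :
      ((gammaLaw (a i)).withDensity fun x => if i = k then ENNReal.ofReal x else 1) =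
        (if i = k then (a i : ℝ≥0∞) else 1) • gammaLaw ((a + Pi.single k 1 : ι → ℝ≥0) i) := by
    split_ifs with h
    · simp [h, gammaLaw_withDensity_id]
    · simp [h]
  have hne (i : ι) : (if i = k then (a i : ℝ≥0∞) else 1) ≠ ∞ := by split_ifs <;> simp
  have (i : ι) : SigmaFinite ((gammaLaw (a i)).withDensity
      fun x => if i = k then ENNReal.ofReal x else 1) := by
    have := Measure.smul_finite (gammaLaw ((a + Pi.single k 1 : ι → ℝ≥0) i)) (hne i)
    rw [hbias]
    infer_instance
  simp_rw [hprod]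
  rw [gammaVec, ← pi_withDensity _ (f := fun i x => if i = k then ENNReal.ofReal x else 1)
    fun i => by split_ifs <;> fun_prop]
  simp_rw [hbias]
  rw [pi_smul_measure _ _ hne, Finset.prod_ite_eq' Finset.univ k, if_pos (Finset.mem_univ k)]
  rfl

theorem sum_smul_map_normalize_withDensity [DecidableEq ι] (ha : 0 < ∑ i, a i) (k : ι) :
    ((∑ i, a i : ℝ≥0) : ℝ≥0∞) •
        ((gammaVec a).map normalize).withDensity (fun x => ENNReal.ofReal (x k)) =
      (a k : ℝ≥0∞) • (gammaVec (a + Pi.single k 1)).map normalize := by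
  ext D hD
  have hD' : MeasurableSet (normalize ⁻¹' D) := measurable_normalize hD
  have hk : Measurable (D.indicator fun x : ι → ℝ => ENNReal.ofReal (x k)) :=
    Measurable.indicator (by fun_prop) hD
  simp only [Measure.smul_apply, smul_eq_mul, withDensity_apply _ hD, Measure.map_apply
    measurable_normalize hD]
  calc (∑ i, a i : ℝ≥0) * ∫⁻ x in D, ENNReal.ofReal (x k) ∂(gammaVec a).map normalize
      = ∫⁻ p, ENNReal.ofReal p.1 * D.indicator (fun x => ENNReal.ofReal (x k)) p.2
          ∂(gammaLaw (∑ i, a i : ℝ≥0)).prod ((gammaVec a).map normalize) := by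
        rw [lintegral_prod_mul (f := fun x => ENNReal.ofReal x) (by fun_prop) hk.aemeasurable,
          lintegral_id_gammaLaw, lintegral_indicator hD]
    _ = ∫⁻ g, ENNReal.ofReal (∑ i, g i) *
          D.indicator (fun x => ENNReal.ofReal (x k)) (normalize g) ∂gammaVec a := by
        rw [← gammaVec_map_sum_normalize, lintegral_map (by fun_prop) (by fun_prop)]
    _ = ∫⁻ g in normalize ⁻¹' D, ENNReal.ofReal (g k) ∂gammaVec a := by
        rw [← lintegral_indicator hD']
        refine lintegral_congr_ae ?_
        filter_upwards [ae_gammaVec_sum_pos a ha] with g hg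
        by_cases h : normalize g ∈ D
        · rw [Set.indicator_of_mem h, Set.indicator_of_mem (Set.mem_preimage.2 h),
            ← ENNReal.ofReal_mul hg.le, normalize, mul_div_cancel₀ _ hg.ne']
        · rw [Set.indicator_of_notMem h, Set.indicator_of_notMem (by simpa using h), mul_zero]
    _ = a k * gammaVec (a + Pi.single k 1) (normalize ⁻¹' D) := by
        rw [← withDensity_apply _ hD', gammaVec_withDensity_apply, Measure.smul_apply, smul_eq_mul]

end GammaVec

/-! ### Cell masses of probability measures -/

section Cells

variable {E : Type*} [MeasurableSpace E] {d : ℕ}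

/-- The masses that a probability measure gives to the cells of the partition into level sets
of `c`. -/
noncomputable def cells (c : E → Fin (d + 1)) (lam : ProbabilityMeasure E) : Fin (d + 1) → ℝ :=
  fun i => (lam : Measure E).real (c ⁻¹' {i})

/-- The masses that the parameter `α` gives to the level sets of `c`, as parameters of a Dirichlet
distribution. -/
noncomputable def cellMass (c : E → Fin (d + 1)) (α : Measure E) : Fin (d + 1) → ℝ≥0 :=
  fun i => (α (c ⁻¹' {i})).toNNReal

theorem measurable_coe_apply {B : Set E} (hB : MeasurableSet B) :
    Measurable fun lam : ProbabilityMeasure E => (lam : Measure E) B :=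
  (Measure.measurable_coe hB).comp measurable_subtype_coe

theorem measurable_cells {c : E → Fin (d + 1)} (hc : Measurable c) : Measurable (cells c) :=
  measurable_pi_lambda _ fun i =>
    (measurable_coe_apply (hc (measurableSet_singleton i))).ennreal_toReal

theorem measure_preimage_eq_sum (α : Measure E) {c : E → Fin (d + 1)} (hc : Measurable c)
    (F : Finset (Fin (d + 1))) : α (c ⁻¹' F) = ∑ j ∈ F, α (c ⁻¹' {j}) := by
  rw [sum_measure_preimage_singleton F fun i _ => hc (measurableSet_singleton i)]

theorem sum_cellMass (α : Measure E) [IsFiniteMeasure α] {c : E → Fin (d + 1)}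
    (hc : Measurable c) : ∑ i, cellMass c α i = (α Set.univ).toNNReal := by
  simp only [cellMass]
  rw [← ENNReal.toNNReal_sum fun _ _ => measure_ne_top _ _, ← measure_preimage_eq_sum _ hc,
    Finset.coe_univ, Set.preimage_univ]

theorem sum_cells {c : E → Fin (d + 1)} (hc : Measurable c) (lam : ProbabilityMeasure E) :
    ∑ i, cells c lam i = 1 := by
  have := congrArg NNReal.toReal (sum_cellMass (lam : Measure E) hc)
  rwa [measure_univ, ENNReal.toNNReal_one, NNReal.coe_one, NNReal.coe_sum] at this

theorem cellMass_add (c : E → Fin (d + 1)) (α β : Measure E) [IsFiniteMeasure α]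
    [IsFiniteMeasure β] : cellMass c (α + β) = cellMass c α + cellMass c β := by
  ext i
  simp only [cellMass, Measure.add_apply, Pi.add_apply,
    ENNReal.toNNReal_add (measure_ne_top α _) (measure_ne_top β _)]

theorem cellMass_dirac {c : E → Fin (d + 1)} (hc : Measurable c) (x : E) :
    cellMass c (Measure.dirac x) = Pi.single (c x) 1 := by
  ext i
  rw [cellMass, Measure.dirac_apply' _ (hc (measurableSet_singleton i))]
  rcases eq_or_ne i (c x) with rfl | h
  · simp
  · simp [h, h.symm]

theorem cellMass_sum_dirac {ι : Type*} [Fintype ι] {c : E → Fin (d + 1)} (hc : Measurable c)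
    (x : ι → E) : cellMass c (∑ j, Measure.dirac (x j)) = ∑ j, Pi.single (c (x j)) 1 := by
  simp only [← cellMass_dirac hc]
  ext i
  simp only [cellMass, Measure.finsetSum_apply, Finset.sum_apply,
    ENNReal.toNNReal_sum fun _ _ => measure_ne_top _ _]

theorem cells_comp {d' : ℕ} {c : E → Fin (d' + 1)} (hc : Measurable c)
    (f : Fin (d' + 1) → Fin (d + 1)) (lam : ProbabilityMeasure E) (i : Fin (d + 1)) :
    cells (f ∘ c) lam i = ∑ j with f j = i, cells c lam j := by
  have : (f ∘ c) ⁻¹' {i} = c ⁻¹' ((Finset.univ.filter fun j => f j = i : Finset _) : Set _) := by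
    ext x
    simp
  simp only [cells, Measure.real]
  rw [this, measure_preimage_eq_sum _ hc, ENNReal.toReal_sum fun _ _ => measure_ne_top _ _]

theorem exists_common_refinement {d' : ℕ} {c : E → Fin (d + 1)} {c' : E → Fin (d' + 1)}
    (hc : Measurable c) (hc' : Measurable c') :
    ∃ (n : ℕ) (b : E → Fin (n + 1)) (f : Fin (n + 1) → Fin (d + 1))
      (f' : Fin (n + 1) → Fin (d' + 1)), Measurable b ∧ c = f ∘ b ∧ c' = f' ∘ b := by
  have hcard : Fintype.card (Fin (d + 1) × Fin (d' + 1)) = ((d + 1) * (d' + 1) - 1) + 1 := by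
    have : 0 < (d + 1) * (d' + 1) := by positivity
    simp only [Fintype.card_prod, Fintype.card_fin]
    omega
  let e := Fintype.equivFinOfCardEq hcard
  refine ⟨_, fun x => e (c x, c' x), fun j => (e.symm j).1, fun j => (e.symm j).2, ?_, ?_, ?_⟩
  · exact (Measurable.of_discrete (f := e)).comp (hc.prodMk hc')
  · ext x
    simp
  · ext x
    simp

variable (E) in
/-- The events that depend only on the masses of the cells of a finite measurable partition. -/
def cylinders : Set (Set (ProbabilityMeasure E)) :=
  {s | ∃ (d : ℕ) (c : E → Fin (d + 1)) (D : Set (Fin (d + 1) → ℝ)),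
    Measurable c ∧ MeasurableSet D ∧ s = cells c ⁻¹' D}

theorem preimage_cells_comp {d' : ℕ} {c : E → Fin (d' + 1)} (hc : Measurable c)
    (f : Fin (d' + 1) → Fin (d + 1)) {D : Set (Fin (d + 1) → ℝ)} (hD : MeasurableSet D) :
    ∃ D' : Set (Fin (d' + 1) → ℝ), MeasurableSet D' ∧ cells (f ∘ c) ⁻¹' D = cells c ⁻¹' D' := by
  refine ⟨(fun v i => ∑ j with f j = i, v j) ⁻¹' D,
    (by fun_prop : Measurable fun (v : Fin (d' + 1) → ℝ) i => ∑ j with f j = i, v j) hD, ?_⟩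
  rw [← Set.preimage_comp]
  exact congrArg (· ⁻¹' D) (funext fun lam => funext (cells_comp hc f lam))

theorem isPiSystem_cylinders : IsPiSystem (cylinders E) := by
  rintro _ ⟨d, c, D, hc, hD, rfl⟩ _ ⟨d', c', D', hc', hD', rfl⟩ -
  obtain ⟨n, b, f, f', hb, rfl, rfl⟩ := exists_common_refinement hc hc'
  obtain ⟨D₁, hD₁, h₁⟩ := preimage_cells_comp hb f hD
  obtain ⟨D₂, hD₂, h₂⟩ := preimage_cells_comp hb f' hD'
  exact ⟨n, b, D₁ ∩ D₂, hb, hD₁.inter hD₂, by rw [h₁, h₂, Set.preimage_inter]⟩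

/-- The partition into a set and its complement, the set being the cell `1`. -/
noncomputable def bipartition (B : Set E) : E → Fin (1 + 1) := B.indicator 1

theorem measurable_bipartition {B : Set E} (hB : MeasurableSet B) : Measurable (bipartition B) :=
  measurable_one.indicator hB

omit [MeasurableSpace E] in
theorem bipartition_preimage_one (B : Set E) : bipartition B ⁻¹' {1} = B := by
  ext x
  by_cases hx : x ∈ B <;> simp [bipartition, hx]

theorem generateFrom_cylinders :
    (inferInstance : MeasurableSpace (ProbabilityMeasure E)) =
      MeasurableSpace.generateFrom (cylinders E) := by
  refine le_antisymm (Measurable.comap_le ?_) (MeasurableSpace.generateFrom_le ?_)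
  · refine @Measure.measurable_of_measurable_coe _ _ _ (.generateFrom (cylinders E)) _
      fun B hB => ?_
    have hcells : Measurable[.generateFrom (cylinders E)] (cells (bipartition B)) := fun D hD =>
      MeasurableSpace.measurableSet_generateFrom ⟨1, _, D, measurable_bipartition hB, hD, rfl⟩
    convert (by fun_prop : Measurable fun v : Fin (1 + 1) → ℝ => ENNReal.ofReal (v 1)).comp hcells
      with lam
    rw [Function.comp_apply, cells, bipartition_preimage_one, ofReal_measureReal]
    rfl
  · rintro _ ⟨d, c, D, hc, hD, rfl⟩
    exact measurable_cells hc hD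

theorem ext_of_cylinders {Q Q' : Measure (ProbabilityMeasure E)} [IsFiniteMeasure Q]
    (h : ∀ s ∈ cylinders E, Q s = Q' s) : Q = Q' :=
  ext_of_generate_finite _ generateFrom_cylinders isPiSystem_cylinders h
    (h _ ⟨0, fun _ => 0, Set.univ, measurable_const, .univ, rfl⟩)

end Cells

/-! ### Dirichlet processes -/

section Mix

variable {E : Type*} [MeasurableSpace E] {d : ℕ}

/-- The convex combination `(1 - w) lam + w lam'`. -/
noncomputable def mix (w : unitInterval) (lam lam' : ProbabilityMeasure E) :
    ProbabilityMeasure E :=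
  ⟨ENNReal.ofReal (1 - w) • (lam : Measure E) + ENNReal.ofReal w • (lam' : Measure E),
    ⟨by simp [← ENNReal.ofReal_add (sub_nonneg.2 w.2.2) w.2.1]⟩⟩

theorem measurable_mix {X : Type*} [MeasurableSpace X] {w : X → unitInterval}
    {lam lam' : X → ProbabilityMeasure E} (hw : Measurable w) (hlam : Measurable lam)
    (hlam' : Measurable lam') : Measurable fun x => mix (w x) (lam x) (lam' x) := by
  refine Measurable.subtype_mk (Measure.measurable_of_measurable_coe _ fun s hs => ?_)
  have := measurable_coe_apply hs
  simp only [Measure.add_apply, Measure.smul_apply, smul_eq_mul]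
  fun_prop

theorem cells_mix (c : E → Fin (d + 1)) (w : unitInterval) (lam lam' : ProbabilityMeasure E) :
    cells c (mix w lam lam') = (1 - w : ℝ) • cells c lam + (w : ℝ) • cells c lam' := by
  have := Measure.smul_finite (lam : Measure E) (ENNReal.ofReal_ne_top (r := 1 - w))
  have := Measure.smul_finite (lam' : Measure E) (ENNReal.ofReal_ne_top (r := w))
  ext i
  simp only [cells, mix, ProbabilityMeasure.coe_mk, Pi.add_apply, Pi.smul_apply, smul_eq_mul]
  rw [measureReal_add_apply, measureReal_ennreal_smul_apply, measureReal_ennreal_smul_apply,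
    ENNReal.toReal_ofReal (sub_nonneg.2 w.2.2), ENNReal.toReal_ofReal w.2.1]

theorem cells_mix_eq_normalize {c : E → Fin (d + 1)} (hc : Measurable c) {t u : ℝ} (ht : 0 < t)
    (hu : 0 < u) (lam lam' : ProbabilityMeasure E) :
    cells c (mix (Set.projIcc 0 1 zero_le_one (u / (t + u))) lam lam') =
      normalize (t • cells c lam + u • cells c lam') := by
  have hw : u / (t + u) ∈ Set.Icc (0 : ℝ) 1 :=
    ⟨by positivity, (div_le_one (by positivity)).2 (by linarith)⟩
  rw [cells_mix, Set.projIcc_of_mem _ hw]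
  ext i
  simp only [normalize, Pi.add_apply, Pi.smul_apply, smul_eq_mul, Finset.sum_add_distrib,
    ← Finset.mul_sum, sum_cells hc, mul_one]
  field_simp
  ring

end Mix

section DirichletProcess

variable {E : Type*} [MeasurableSpace E] {d : ℕ} {α β : Measure E}
  {Q : Measure (ProbabilityMeasure E)}

theorem IsDirichletProcessLaw.map_cells (h : IsDirichletProcessLaw α Q) {c : E → Fin (d + 1)}
    (hc : Measurable c) : Q.map (cells c) = (gammaVec (cellMass c α)).map normalize := by
  refine h.map_eq d (fun i => c ⁻¹' {i}) (fun i => hc (measurableSet_singleton i)) ?_ ?_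
  · exact fun i j hij => Set.disjoint_left.mpr fun x hx hx' => hij (hx.symm.trans hx')
  · ext x
    simp

theorem isDirichletProcessLaw_of_map_cells [IsProbabilityMeasure Q]
    (h : ∀ (d : ℕ) (c : E → Fin (d + 1)), Measurable c →
      Q.map (cells c) = (gammaVec (cellMass c α)).map normalize) :
    IsDirichletProcessLaw α Q := by
  refine ⟨inferInstance, fun d B hB hdisj hcover => ?_⟩
  choose c hc using fun x => Set.mem_iUnion.1 (hcover ▸ Set.mem_univ x)
  have hpre (i : Fin (d + 1)) : c ⁻¹' {i} = B i := by
    ext x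
    refine ⟨fun hx => hx ▸ hc x, fun hx => ?_⟩
    by_contra hne
    exact Set.disjoint_left.mp (hdisj hne) (hc x) hx
  obtain rfl : (fun i => c ⁻¹' {i}) = B := funext hpre
  exact h d c (measurable_to_countable' hB)

/-- `α` is a nonzero finite measure for which a Dirichlet process exists. -/
structure HasDirichletLaw (α : Measure E) : Prop where
  isFiniteMeasure : IsFiniteMeasure α
  ne_zero : α ≠ 0
  exists_law : ∃ Q, IsDirichletProcessLaw α Q

theorem not_isDirichletProcessLaw_zero : ¬ IsDirichletProcessLaw (0 : Measure E) Q := by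
  intro h
  let c : E → Fin (0 + 1) := fun _ => 0
  have hcm := measurable_cells (measurable_const : Measurable c)
  have hlaw : Q.map (cells c) = Measure.dirac (normalize 0) := by
    have hmass : cellMass c 0 = 0 := rfl
    rw [h.map_cells measurable_const, hmass, gammaVec_zero, Measure.map_dirac' measurable_normalize]
  have hsum : MeasurableSet {v : Fin (0 + 1) → ℝ | ∑ i, v i = 1} :=
    measurableSet_eq_fun (by fun_prop) measurable_const
  have hae : ∀ᵐ v ∂Q.map (cells c), ∑ i, v i = 1 :=
    (ae_map_iff hcm.aemeasurable hsum).2 (ae_of_all _ (sum_cells measurable_const))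
  rw [hlaw, ae_dirac_iff hsum] at hae
  simp [normalize] at hae

theorem hasDirichletLaw_of_ne_zero [IsFiniteMeasure α] (h : dirichletLaw α ≠ 0) :
    HasDirichletLaw α := by
  have hex : ∃ Q, IsDirichletProcessLaw α Q := by
    by_contra hcon
    exact h (by rw [dirichletLaw, dif_neg hcon])
  refine ⟨inferInstance, fun h0 => ?_, hex⟩
  obtain ⟨Q, hQ⟩ := hex
  exact not_isDirichletProcessLaw_zero (h0 ▸ hQ)

theorem HasDirichletLaw.spec (h : HasDirichletLaw α) :
    IsDirichletProcessLaw α (dirichletLaw α) := by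
  rw [dirichletLaw, dif_pos h.exists_law]
  exact h.exists_law.choose_spec

theorem HasDirichletLaw.isProbabilityMeasure (h : HasDirichletLaw α) :
    IsProbabilityMeasure (dirichletLaw α) := h.spec.isProbabilityMeasure

theorem HasDirichletLaw.toNNReal_univ_pos (h : HasDirichletLaw α) :
    0 < (α Set.univ).toNNReal :=
  have := h.isFiniteMeasure
  ENNReal.toNNReal_pos (Measure.measure_univ_ne_zero.2 h.ne_zero) (measure_ne_top _ _)

theorem HasDirichletLaw.map_gammaLaw_smul_cells (h : HasDirichletLaw α) {c : E → Fin (d + 1)}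
    (hc : Measurable c) :
    ((gammaLaw (α Set.univ).toNNReal).prod (dirichletLaw α)).map (fun p => p.1 • cells c p.2) =
      gammaVec (cellMass c α) := by
  have := h.isFiniteMeasure
  have := h.isProbabilityMeasure
  have hcells := measurable_cells hc
  rw [← prod_map_smul_normalize (cellMass c α) (sum_cellMass α hc ▸ h.toNNReal_univ_pos),
    sum_cellMass α hc, ← h.spec.map_cells hc]
  conv_rhs => rw [← Measure.map_id (μ := gammaLaw _), Measure.map_prod_map _ _ measurable_id hcells]
  rw [Measure.map_map (by fun_prop) (by fun_prop)]
  rfl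

/- If `T lam` and `U lam'` are the random measures with independent gamma masses on disjoint sets,
then so is their sum `T lam + U lam'`, and normalizing it mixes `lam` and `lam'`. -/
theorem HasDirichletLaw.add (hα : HasDirichletLaw α) (hβ : HasDirichletLaw β) :
    HasDirichletLaw (α + β) := by
  have := hα.isFiniteMeasure
  have := hβ.isFiniteMeasure
  have := hα.isProbabilityMeasure
  have := hβ.isProbabilityMeasure
  let ρ := ((gammaLaw (α Set.univ).toNNReal).prod (dirichletLaw α)).prod
    ((gammaLaw (β Set.univ).toNNReal).prod (dirichletLaw β))
  let X : (ℝ × ProbabilityMeasure E) × (ℝ × ProbabilityMeasure E) → ProbabilityMeasure E :=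
    fun p => mix (Set.projIcc 0 1 zero_le_one (p.2.1 / (p.1.1 + p.2.1))) p.1.2 p.2.2
  have hX : Measurable X :=
    measurable_mix (continuous_projIcc.measurable.comp (by fun_prop)) (by fun_prop) (by fun_prop)
  have := Measure.isProbabilityMeasure_map (μ := ρ) hX.aemeasurable
  have hne : α + β ≠ 0 := fun h0 => hα.ne_zero
    (Measure.nonpos_iff_eq_zero'.1 ((Measure.le_add_right le_rfl).trans_eq h0))
  refine ⟨inferInstance, hne, ρ.map X, isDirichletProcessLaw_of_map_cells fun d c hc => ?_⟩
  have hcells := measurable_cells hc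
  have hT : ∀ᵐ p ∂ρ, 0 < p.1.1 :=
    Measure.quasiMeasurePreserving_fst.ae (Measure.quasiMeasurePreserving_fst.ae
      (ae_gammaLaw_pos (NNReal.coe_pos.2 hα.toNNReal_univ_pos)))
  have hU : ∀ᵐ p ∂ρ, 0 < p.2.1 :=
    Measure.quasiMeasurePreserving_snd.ae (Measure.quasiMeasurePreserving_fst.ae
      (ae_gammaLaw_pos (NNReal.coe_pos.2 hβ.toNNReal_univ_pos)))
  calc (ρ.map X).map (cells c)
      = ρ.map fun p => normalize (p.1.1 • cells c p.1.2 + p.2.1 • cells c p.2.2) := by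
        rw [Measure.map_map hcells hX]
        refine Measure.map_congr ?_
        filter_upwards [hT, hU] with p ht hu
        exact cells_mix_eq_normalize hc ht hu _ _
    _ = ((gammaVec (cellMass c α)).conv (gammaVec (cellMass c β))).map normalize := by
        rw [← hα.map_gammaLaw_smul_cells hc, ← hβ.map_gammaLaw_smul_cells hc, Measure.conv,
          Measure.map_prod_map _ _ (by fun_prop) (by fun_prop),
          Measure.map_map (by fun_prop) (by fun_prop), Measure.map_map (by fun_prop) (by fun_prop)]
        rfl
    _ = (gammaVec (cellMass c (α + β))).map normalize := by rw [gammaVec_conv, cellMass_add]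

theorem hasDirichletLaw_dirac (x : E) : HasDirichletLaw (Measure.dirac x) := by
  let δ : ProbabilityMeasure E := ⟨Measure.dirac x, inferInstance⟩
  refine ⟨inferInstance, IsProbabilityMeasure.ne_zero _, Measure.dirac δ,
    isDirichletProcessLaw_of_map_cells fun d c hc => ?_⟩
  have hpos : ∀ᵐ t ∂gammaLaw (1 : ℝ≥0), 0 < t := ae_gammaLaw_pos (by norm_num)
  have hcells : cells c δ = Pi.single (c x) 1 := by
    ext i
    refine (congrArg NNReal.toReal (congrFun (cellMass_dirac hc x) i)).trans ?_
    rcases eq_or_ne i (c x) with rfl | h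
    · simp
    · simp [h]
  rw [Measure.map_dirac' (measurable_cells hc), cellMass_dirac hc, gammaVec_single,
    Measure.map_map measurable_normalize (measurable_piSingle _), hcells]
  calc Measure.dirac (Pi.single (c x) 1)
      = (gammaLaw (1 : ℝ≥0)).map fun _ => Pi.single (c x) 1 := by
        rw [Measure.map_const, measure_univ, one_smul]
    _ = (gammaLaw (1 : ℝ≥0)).map (normalize ∘ Pi.single (c x)) := by
        refine Measure.map_congr ?_
        filter_upwards [hpos] with t ht
        ext i
        simp only [Function.comp_apply, normalize, Finset.sum_pi_single', Finset.mem_univ, if_true]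
        rcases eq_or_ne i (c x) with rfl | h
        · simp [ht.ne']
        · simp [h]

theorem HasDirichletLaw.add_sum_dirac (h : HasDirichletLaw α) {ι : Type*} [Fintype ι]
    (x : ι → E) : HasDirichletLaw (α + ∑ j, Measure.dirac (x j)) := by
  classical
  induction (Finset.univ : Finset ι) using Finset.induction_on with
  | empty => simpa using h
  | insert j s hj ih =>
    rw [Finset.sum_insert hj, add_left_comm]
    exact (hasDirichletLaw_dirac (x j)).add ih

theorem HasDirichletLaw.measurable_add_sum_dirac (h : HasDirichletLaw α) (ι : Type*)
    [Fintype ι] : Measurable fun x : ι → E => dirichletLaw (α + ∑ j, Measure.dirac (x j)) := by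
  have := fun x : ι → E => (h.add_sum_dirac x).isProbabilityMeasure
  have := h.isFiniteMeasure
  refine Measurable.measure_of_isPiSystem_of_isProbabilityMeasure generateFrom_cylinders
    isPiSystem_cylinders ?_
  rintro _ ⟨d, c, D, hc, hD, rfl⟩
  have hcells (x : ι → E) : dirichletLaw (α + ∑ j, Measure.dirac (x j)) (cells c ⁻¹' D) =
      (gammaVec (cellMass c α + ∑ j, Pi.single (c (x j)) 1)).map normalize D := by
    rw [← Measure.map_apply (measurable_cells hc) hD, (h.add_sum_dirac x).spec.map_cells hc,
      cellMass_add, cellMass_sum_dirac hc]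
  simp_rw [hcells]
  have hk : Measurable fun k : ι → Fin (d + 1) =>
      (gammaVec (cellMass c α + ∑ j, Pi.single (k j) 1)).map normalize D := .of_discrete
  exact hk.comp (measurable_pi_lambda _ fun j => hc.comp (measurable_pi_apply j))

theorem HasDirichletLaw.measurable_add_dirac (h : HasDirichletLaw α) :
    Measurable fun x : E => dirichletLaw (α + Measure.dirac x) := by
  have := (h.measurable_add_sum_dirac Unit).comp
    (measurable_pi_lambda (fun (x : E) (_ : Unit) => x) fun _ => measurable_id)
  simpa only [Function.comp_def, Finset.univ_unique, Finset.sum_singleton] using this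

end DirichletProcess

/-! ### Sampling from a Dirichlet process -/

section Sampling

variable (ι E : Type*) [MeasurableSpace E]

/-- Sampling a family of independent points, indexed by `ι`, from a probability measure. -/
noncomputable def iidKernel : Kernel (ProbabilityMeasure E) (ι → E) where
  toFun lam := Measure.infinitePi fun _ => (lam : Measure E)
  measurable' := by
    refine Measurable.measure_of_isPiSystem_of_isProbabilityMeasure
      generateFrom_squareCylinders.symm
      (isPiSystem_squareCylinders (fun _ => MeasurableSpace.isPiSystem_measurableSet)
        fun _ => .univ) ?_
    rintro _ ⟨s, t, ht, rfl⟩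
    simp_rw [Measure.infinitePi_pi _ fun i _ => ht i trivial]
    exact Finset.measurable_prod _ fun i _ => measurable_coe_apply (ht i trivial)

instance : IsMarkovKernel (iidKernel ι E) :=
  ⟨fun lam => inferInstanceAs
    (IsProbabilityMeasure (Measure.infinitePi fun _ => (lam : Measure E)))⟩

/-- Sampling one point from a probability measure. -/
noncomputable def evalKernel : Kernel (ProbabilityMeasure E) E :=
  ⟨fun lam => lam, measurable_subtype_coe⟩

instance : IsMarkovKernel (evalKernel E) := ⟨fun lam => lam.2⟩

variable {ι E}

theorem iidKernel_apply [Fintype ι] (lam : ProbabilityMeasure E) :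
    iidKernel ι E lam = Measure.pi fun _ => (lam : Measure E) :=
  Measure.infinitePi_eq_pi _

theorem measurable_insertNth {n : ℕ} (p : Fin (n + 1)) :
    Measurable fun z : E × (Fin n → E) => p.insertNth (α := fun _ => E) z.1 z.2 :=
  (MeasurableEquiv.piFinSuccAbove (fun _ => E) p).symm.measurable

theorem lintegral_iidKernel_succ {n : ℕ} (p : Fin (n + 1)) (lam : ProbabilityMeasure E)
    {f : (Fin (n + 1) → E) → ℝ≥0∞} (hf : Measurable f) :
    ∫⁻ x, f x ∂iidKernel (Fin (n + 1)) E lam =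
      ∫⁻ y, ∫⁻ x, f (p.insertNth y x) ∂iidKernel (Fin n) E lam ∂(lam : Measure E) := by
  have h := (measurePreserving_piFinSuccAbove (fun _ => (lam : Measure E)) p).symm
  have hg : Measurable fun z : E × (Fin n → E) => f (p.insertNth z.1 z.2) :=
    hf.comp (measurable_insertNth p)
  rw [iidKernel_apply, iidKernel_apply, ← lintegral_prod _ hg.aemeasurable, ← h.lintegral_comp hf]
  rfl

end Sampling

section Posterior

variable {E : Type*} [MeasurableSpace E] {d : ℕ} {α : Measure E}

theorem HasDirichletLaw.mul_left_cancel (h : HasDirichletLaw α) {u v : ℝ≥0∞}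
    (huv : α Set.univ * u = α Set.univ * v) : u = v :=
  have := h.isFiniteMeasure
  (ENNReal.mul_right_inj (Measure.measure_univ_ne_zero.2 h.ne_zero) (measure_ne_top _ _)).1 huv

theorem HasDirichletLaw.setLIntegral_cell (h : HasDirichletLaw α) {c : E → Fin (d + 1)}
    (hc : Measurable c) {D : Set (Fin (d + 1) → ℝ)} (hD : MeasurableSet D) (k : Fin (d + 1)) :
    α Set.univ * ∫⁻ lam in cells c ⁻¹' D, (lam : Measure E) (c ⁻¹' {k}) ∂dirichletLaw α =
      ∫⁻ x in c ⁻¹' {k}, dirichletLaw (α + Measure.dirac x) (cells c ⁻¹' D) ∂α := by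
  have := h.isFiniteMeasure
  have hcm := measurable_cells hc
  calc α Set.univ * ∫⁻ lam in cells c ⁻¹' D, (lam : Measure E) (c ⁻¹' {k}) ∂dirichletLaw α
      = α Set.univ * ∫⁻ v in D, ENNReal.ofReal (v k) ∂(dirichletLaw α).map (cells c) := by
        rw [setLIntegral_map hD (by fun_prop) hcm]
        exact congrArg _ (lintegral_congr fun lam => (ofReal_measureReal).symm)
    _ = α (c ⁻¹' {k}) *
          (gammaVec (cellMass c α + Pi.single k 1)).map normalize D := by
        have := congrArg (· D) (sum_smul_map_normalize_withDensity (cellMass c α)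
          (sum_cellMass α hc ▸ h.toNNReal_univ_pos) k)
        rw [sum_cellMass α hc] at this
        simpa only [Measure.smul_apply, smul_eq_mul, withDensity_apply _ hD, cellMass,
          ENNReal.coe_toNNReal (measure_ne_top α _), h.spec.map_cells hc] using this
    _ = ∫⁻ x in c ⁻¹' {k}, dirichletLaw (α + Measure.dirac x) (cells c ⁻¹' D) ∂α := by
        rw [mul_comm, ← setLIntegral_const]
        refine setLIntegral_congr_fun (hc (measurableSet_singleton k)) fun x hx => ?_
        rw [← Measure.map_apply hcm hD, (h.add (hasDirichletLaw_dirac x)).spec.map_cells hc,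
          cellMass_add, cellMass_dirac hc, show c x = k from hx]

theorem HasDirichletLaw.setLIntegral_cylinder (h : HasDirichletLaw α)
    {s : Set (ProbabilityMeasure E)} (hs : s ∈ cylinders E) {B : Set E} (hB : MeasurableSet B) :
    α Set.univ * ∫⁻ lam in s, (lam : Measure E) B ∂dirichletLaw α =
      ∫⁻ x in B, dirichletLaw (α + Measure.dirac x) s ∂α := by
  obtain ⟨d, c, D, hc, hD, rfl⟩ := hs
  obtain ⟨n, b, f, f', hb, rfl, hB'⟩ := exists_common_refinement hc (measurable_bipartition hB)
  obtain ⟨D', hD', hpre⟩ := preimage_cells_comp hb f hD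
  let F : Finset (Fin (n + 1)) := {j | f' j = 1}
  have hBF : B = b ⁻¹' (F : Set (Fin (n + 1))) := by
    rw [← bipartition_preimage_one B, hB']
    ext x
    simp [F]
  have hbm (j : Fin (n + 1)) : MeasurableSet (b ⁻¹' {j}) := hb (measurableSet_singleton j)
  have hcells : b ⁻¹' (F : Set (Fin (n + 1))) = ⋃ j ∈ F, b ⁻¹' {j} := by
    ext x
    simp
  have hdisj : (F : Set (Fin (n + 1))).PairwiseDisjoint fun j => b ⁻¹' {j} :=
    fun i _ j _ hij => Disjoint.preimage _ (Set.disjoint_singleton.2 hij)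
  simp_rw [hpre, hBF, measure_preimage_eq_sum _ hb]
  rw [lintegral_finsetSum _ fun j _ => measurable_coe_apply (hbm j), Finset.mul_sum, hcells,
    lintegral_biUnion_finset hdisj fun j _ => hbm j]
  exact Finset.sum_congr rfl fun j _ => h.setLIntegral_cell hb hD' j

/-- The law of the updated Dirichlet process, as a function of the observations. -/
noncomputable def HasDirichletLaw.posterior (h : HasDirichletLaw α) (ι : Type*) [Fintype ι] :
    Kernel (ι → E) (ProbabilityMeasure E) :=
  ⟨fun x => dirichletLaw (α + ∑ j, Measure.dirac (x j)), h.measurable_add_sum_dirac ι⟩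

instance (h : HasDirichletLaw α) (ι : Type*) [Fintype ι] : IsMarkovKernel (h.posterior ι) :=
  ⟨fun x => (h.add_sum_dirac x).isProbabilityMeasure⟩

theorem HasDirichletLaw.smul_withDensity (h : HasDirichletLaw α) {B : Set E}
    (hB : MeasurableSet B) :
    α Set.univ • (dirichletLaw α).withDensity (fun lam => (lam : Measure E) B) =
      (α.restrict B).bind fun x => dirichletLaw (α + Measure.dirac x) := by
  have := h.isFiniteMeasure
  have := h.isProbabilityMeasure
  have : IsFiniteMeasure ((dirichletLaw α).withDensity fun lam => (lam : Measure E) B) :=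
    isFiniteMeasure_withDensity
      ((lintegral_mono fun lam => prob_le_one).trans_lt (by simp)).ne
  have := Measure.smul_finite ((dirichletLaw α).withDensity fun lam => (lam : Measure E) B)
    (measure_ne_top α Set.univ)
  refine ext_of_cylinders fun s hs => ?_
  have hsm : MeasurableSet s := by
    obtain ⟨d, c, D, hc, hD, rfl⟩ := hs
    exact measurable_cells hc hD
  rw [Measure.smul_apply, smul_eq_mul, withDensity_apply _ hsm, h.setLIntegral_cylinder hs hB,
    Measure.bind_apply hsm h.measurable_add_dirac.aemeasurable]

theorem HasDirichletLaw.smul_compProd_evalKernel (h : HasDirichletLaw α) :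
    α Set.univ • (dirichletLaw α ⊗ₘ evalKernel E) =
      (α ⊗ₘ ⟨_, h.measurable_add_dirac⟩).map Prod.swap := by
  have := h.isFiniteMeasure
  have := h.isProbabilityMeasure
  have : IsMarkovKernel (⟨_, h.measurable_add_dirac⟩ : Kernel E (ProbabilityMeasure E)) :=
    ⟨fun x => (h.add (hasDirichletLaw_dirac x)).isProbabilityMeasure⟩
  have := Measure.smul_finite (dirichletLaw α ⊗ₘ evalKernel E) (measure_ne_top α Set.univ)
  refine Measure.ext_prod fun {s B} hs hB => ?_
  rw [Measure.smul_apply, smul_eq_mul, Measure.compProd_apply_prod hs hB,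
    Measure.map_apply measurable_swap (hs.prod hB), Set.preimage_swap_prod,
    Measure.compProd_apply_prod hB hs]
  have := congrArg (· s) (h.smul_withDensity hB)
  rwa [Measure.smul_apply, smul_eq_mul, withDensity_apply _ hs,
    Measure.bind_apply hs h.measurable_add_dirac.aemeasurable] at this

theorem HasDirichletLaw.mul_lintegral_lintegral (h : HasDirichletLaw α)
    {f : ProbabilityMeasure E × E → ℝ≥0∞} (hf : Measurable f) :
    α Set.univ * ∫⁻ lam, ∫⁻ x, f (lam, x) ∂(lam : Measure E) ∂dirichletLaw α =
      ∫⁻ x, ∫⁻ lam, f (lam, x) ∂dirichletLaw (α + Measure.dirac x) ∂α := by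
  have := h.isFiniteMeasure
  have := h.isProbabilityMeasure
  have : IsMarkovKernel (⟨_, h.measurable_add_dirac⟩ : Kernel E (ProbabilityMeasure E)) :=
    ⟨fun x => (h.add (hasDirichletLaw_dirac x)).isProbabilityMeasure⟩
  have := congrArg (fun ρ => ∫⁻ p, f p ∂ρ) h.smul_compProd_evalKernel
  rwa [lintegral_smul_measure, smul_eq_mul, Measure.lintegral_compProd hf,
    lintegral_map hf measurable_swap,
    Measure.lintegral_compProd (f := fun p : E × ProbabilityMeasure E => f p.swap)
      (hf.comp measurable_swap)] at this

theorem HasDirichletLaw.bind_evalKernel (h : HasDirichletLaw α) :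
    (dirichletLaw α).bind (evalKernel E) = (α Set.univ)⁻¹ • α := by
  have := h.isFiniteMeasure
  ext B hB
  have := h.mul_lintegral_lintegral
    ((measurable_one.indicator hB : Measurable (B.indicator (1 : E → ℝ≥0∞))).comp measurable_snd)
  have hp (x : E) := (h.add (hasDirichletLaw_dirac x)).isProbabilityMeasure
  simp only [Function.comp_apply, lintegral_const, measure_univ, mul_one,
    lintegral_indicator_one hB] at this
  refine h.mul_left_cancel ?_
  rw [Measure.bind_apply hB (evalKernel E).aemeasurable, Measure.smul_apply, smul_eq_mul,
    ← mul_assoc, ENNReal.mul_inv_cancel (Measure.measure_univ_ne_zero.2 h.ne_zero)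
      (measure_ne_top _ _), one_mul]
  exact this

theorem HasDirichletLaw.mul_lintegral_iidKernel_succ (h : HasDirichletLaw α) {n : ℕ}
    (p : Fin (n + 1)) {f : ProbabilityMeasure E × (Fin (n + 1) → E) → ℝ≥0∞} (hf : Measurable f) :
    α Set.univ * ∫⁻ lam, ∫⁻ x, f (lam, x) ∂iidKernel (Fin (n + 1)) E lam ∂dirichletLaw α =
      ∫⁻ y, ∫⁻ lam, ∫⁻ x, f (lam, p.insertNth y x) ∂iidKernel (Fin n) E lam
        ∂dirichletLaw (α + Measure.dirac y) ∂α := by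
  have hg : Measurable fun q : (ProbabilityMeasure E × E) × (Fin n → E) =>
      f (q.1.1, p.insertNth q.1.2 q.2) :=
    hf.comp ((measurable_fst.comp measurable_fst).prodMk ((measurable_insertNth p).comp
      ((measurable_snd.comp measurable_fst).prodMk measurable_snd)))
  have hm : Measurable fun q : ProbabilityMeasure E × E =>
      ∫⁻ x, f (q.1, p.insertNth q.2 x) ∂iidKernel (Fin n) E q.1 :=
    hg.lintegral_kernel_prod_right' (κ := (iidKernel (Fin n) E).comap _ measurable_fst)
  rw [← h.mul_lintegral_lintegral hm]
  refine congrArg _ (lintegral_congr fun lam => ?_)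
  exact lintegral_iidKernel_succ p lam (hf.comp measurable_prodMk_left)

theorem HasDirichletLaw.lintegral_iidKernel (h : HasDirichletLaw α) (n : ℕ)
    {f : ProbabilityMeasure E × (Fin n → E) → ℝ≥0∞} (hf : Measurable f) :
    ∫⁻ lam, ∫⁻ x, f (lam, x) ∂iidKernel (Fin n) E lam ∂dirichletLaw α =
      ∫⁻ lam, ∫⁻ x, ∫⁻ lam', f (lam', x) ∂h.posterior (Fin n) x ∂iidKernel (Fin n) E lam
        ∂dirichletLaw α := by
  induction n generalizing α with
  | zero =>
    have := h.isProbabilityMeasure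
    have hempty (lam : ProbabilityMeasure E) :
        iidKernel (Fin 0) E lam = Measure.dirac Fin.elim0 := by
      rw [iidKernel_apply, Measure.pi_of_empty _ Fin.elim0]
    simp [hempty, HasDirichletLaw.posterior]
  | succ n ih =>
    have hf' : Measurable fun q : ProbabilityMeasure E × (Fin (n + 1) → E) =>
        ∫⁻ lam', f (lam', q.2) ∂h.posterior (Fin (n + 1)) q.2 :=
      ((hf.comp measurable_swap).lintegral_kernel_prod_right').comp measurable_snd
    refine h.mul_left_cancel ?_
    rw [h.mul_lintegral_iidKernel_succ 0 hf, h.mul_lintegral_iidKernel_succ 0 hf']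
    refine lintegral_congr fun y => ?_
    have hm : Measurable fun q : ProbabilityMeasure E × (Fin n → E) =>
        f (q.1, (0 : Fin (n + 1)).insertNth y q.2) :=
      hf.comp (measurable_fst.prodMk
        ((measurable_insertNth 0).comp (measurable_const.prodMk measurable_snd)))
    have hpost (x : Fin n → E) : (h.add (hasDirichletLaw_dirac y)).posterior (Fin n) x =
        h.posterior (Fin (n + 1)) ((0 : Fin (n + 1)).insertNth y x) := by
      simp [HasDirichletLaw.posterior, Fin.sum_univ_succ, add_assoc]
    simp_rw [ih (h.add (hasDirichletLaw_dirac y)) hm, hpost]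

theorem HasDirichletLaw.compProd_iidKernel (h : HasDirichletLaw α) (n : ℕ) :
    dirichletLaw α ⊗ₘ iidKernel (Fin n) E =
      ((dirichletLaw α).bind (iidKernel (Fin n) E) ⊗ₘ h.posterior (Fin n)).map Prod.swap := by
  have := h.isProbabilityMeasure
  refine Measure.ext_of_lintegral _ fun f hf => ?_
  rw [Measure.lintegral_compProd hf, h.lintegral_iidKernel n hf, lintegral_map hf measurable_swap,
    Measure.lintegral_compProd (f := fun q : (Fin n → E) × _ => f q.swap)
      (hf.comp measurable_swap), Measure.lintegral_bind (iidKernel _ E).aemeasurable]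
  · rfl
  · exact (hf.comp measurable_swap).lintegral_kernel_prod_right'.aemeasurable

theorem HasDirichletLaw.withDensity_iidKernel (h : HasDirichletLaw α) {n : ℕ}
    {A : Set (Fin n → E)} (hA : MeasurableSet A) :
    (dirichletLaw α).withDensity (fun lam => iidKernel (Fin n) E lam A) =
      (((dirichletLaw α).bind (iidKernel (Fin n) E)).restrict A).bind (h.posterior (Fin n)) := by
  have := h.isProbabilityMeasure
  ext D hD
  have hjoint := congrArg (· (D ×ˢ A)) (h.compProd_iidKernel n)
  rwa [Measure.compProd_apply_prod hD hA, Measure.map_apply measurable_swap (hD.prod hA),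
    Set.preimage_swap_prod, Measure.compProd_apply_prod hA hD, ← withDensity_apply _ hD,
    ← Measure.bind_apply hD (h.posterior (Fin n)).aemeasurable] at hjoint

end Posterior

/-! ### Conditionally i.i.d. sequences -/

section CondIID

open Filter Topology

variable {Ω E : Type*} [MeasurableSpace Ω] [MeasurableSpace E] {P : Measure Ω}
  [IsProbabilityMeasure P] {η : ℕ → Ω → E} {lam : Ω → ProbabilityMeasure E}

theorem CondIID.measureReal_inter (h : CondIID P η lam) (hη : ∀ i, Measurable (η i))
    (hlam : Measurable lam) {n : ℕ} {B : Fin n → Set E} (hB : ∀ i, MeasurableSet (B i))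
    {D : Set (ProbabilityMeasure E)} (hD : MeasurableSet D) :
    P.real (lam ⁻¹' D ∩ ⋂ i : Fin n, η i ⁻¹' B i) =
      ∫ ω in lam ⁻¹' D, ∏ i, (lam ω : Measure E).real (B i) ∂P := by
  have hs : MeasurableSet (⋂ i : Fin n, η i ⁻¹' B i) :=
    MeasurableSet.iInter fun i => hη i (hB i)
  have hcond := setIntegral_condExp (μ := P) (s := lam ⁻¹' D)
    (f := (⋂ i : Fin n, η i ⁻¹' B i).indicator fun _ => (1 : ℝ)) hlam.comap_le
    ((integrable_const (1 : ℝ)).indicator hs) ⟨D, hD, rfl⟩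
  rw [setIntegral_congr_ae (hlam hD) ((h n B hB).mono fun ω hω _ => hω), integral_indicator hs,
    setIntegral_const, smul_eq_mul, mul_one, measureReal_restrict_apply hs,
    Set.inter_comm] at hcond
  exact hcond.symm

theorem CondIID.measure_inter (h : CondIID P η lam) (hη : ∀ i, Measurable (η i))
    (hlam : Measurable lam) {n : ℕ} {B : Fin n → Set E} (hB : ∀ i, MeasurableSet (B i))
    {D : Set (ProbabilityMeasure E)} (hD : MeasurableSet D) :
    P (lam ⁻¹' D ∩ ⋂ i : Fin n, η i ⁻¹' B i) =
      ∫⁻ ω in lam ⁻¹' D, ∏ i, (lam ω : Measure E) (B i) ∂P := by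
  have hm : Measurable fun ω => ∏ i, (lam ω : Measure E) (B i) :=
    Finset.measurable_fun_prod _ fun i _ => (measurable_coe_apply (hB i)).comp hlam
  have hle (ω : Ω) : ∏ i, (lam ω : Measure E) (B i) ≤ 1 :=
    Finset.prod_le_one' fun _ _ => prob_le_one
  rw [← ENNReal.toReal_eq_toReal_iff' (measure_ne_top _ _)
    ((lintegral_mono fun ω => hle ω).trans_lt (by simp)).ne, ← measureReal_def,
    h.measureReal_inter hη hlam hB hD, ← integral_toReal hm.aemeasurable
      (Eventually.of_forall fun ω => (hle ω).trans_lt ENNReal.one_lt_top)]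
  simp_rw [ENNReal.toReal_prod, measureReal_def]

theorem CondIID.measure_inter_finset (h : CondIID P η lam) (hη : ∀ i, Measurable (η i))
    (hlam : Measurable lam) (s : Finset ℕ) {B : ℕ → Set E} (hB : ∀ i, MeasurableSet (B i))
    {D : Set (ProbabilityMeasure E)} (hD : MeasurableSet D) :
    P (lam ⁻¹' D ∩ ⋂ i ∈ s, η i ⁻¹' B i) =
      ∫⁻ ω in lam ⁻¹' D, ∏ i ∈ s, (lam ω : Measure E) (B i) ∂P := by
  classical
  obtain ⟨n, hn⟩ := s.exists_nat_subset_range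
  let B' (i : ℕ) : Set E := if i ∈ s then B i else Set.univ
  have hB' (i : ℕ) : MeasurableSet (B' i) := by
    dsimp only [B']
    split_ifs
    exacts [hB i, .univ]
  have hset : ⋂ i ∈ s, η i ⁻¹' B i = ⋂ i : Fin n, η i ⁻¹' B' i := by
    ext ω
    simp only [Set.mem_iInter, Set.mem_preimage, B', Set.mem_ite_univ_right]
    exact ⟨fun hω i hi => hω i hi, fun hω i hi => hω ⟨i, Finset.mem_range.1 (hn hi)⟩ hi⟩
  have hprod (ω : Ω) :
      ∏ i ∈ s, (lam ω : Measure E) (B i) = ∏ i : Fin n, (lam ω : Measure E) (B' i) := by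
    rw [Fin.prod_univ_eq_prod_range (fun i => (lam ω : Measure E) (B' i)) n,
      ← Finset.prod_subset hn fun i _ hi => by simp [B', hi]]
    exact Finset.prod_congr rfl fun i hi => by simp [B', hi]
  rw [hset, h.measure_inter hη hlam (fun i => hB' i) hD]
  simp_rw [hprod]

theorem CondIID.map_eq_bind (h : CondIID P η lam) (hη : ∀ i, Measurable (η i))
    (hlam : Measurable lam) (i : ℕ) : P.map (η i) = (P.map lam).bind (evalKernel E) := by
  ext B hB
  have hB' := h.measure_inter_finset hη hlam {i} (fun _ => hB) .univ
  simp only [Set.preimage_univ, Set.univ_inter, Finset.mem_singleton, Set.iInter_iInter_eq_left,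
    Finset.prod_singleton, Measure.restrict_univ] at hB'
  rw [Measure.map_apply (hη i) hB, hB', Measure.bind_apply hB (evalKernel E).aemeasurable,
    lintegral_map ((evalKernel E).measurable_coe hB) hlam]
  rfl

theorem CondIID.map_prodMk_id (h : CondIID P η lam) (hη : ∀ i, Measurable (η i))
    (hlam : Measurable lam) :
    P.map (fun ω => (lam ω, fun i => η i ω)) = P.map lam ⊗ₘ iidKernel ℕ E := by
  have hseq : Measurable fun ω i => η i ω := measurable_pi_lambda _ hη
  have := Measure.isProbabilityMeasure_map (μ := P) (hlam.prodMk hseq).aemeasurable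
  refine Measure.ext_prod fun {D C} hD hC => ?_
  have hrestrict : (P.restrict (lam ⁻¹' D)).map (fun ω i => η i ω) =
      ((P.map lam).restrict D).bind (iidKernel ℕ E) := by
    have huniv : ((P.map lam).restrict D).bind (iidKernel ℕ E) Set.univ = P (lam ⁻¹' D) := by
      rw [Measure.bind_apply .univ (iidKernel ℕ E).aemeasurable]
      simp [Measure.map_apply hlam hD]
    refine ext_of_generate_finite _ generateFrom_squareCylinders.symm
      (isPiSystem_squareCylinders (fun _ => MeasurableSpace.isPiSystem_measurableSet)
        fun _ => .univ) ?_ ?_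
    · rintro _ ⟨s, B, hB, rfl⟩
      have hBm (i : ℕ) : MeasurableSet (B i) := hB i trivial
      have hs : MeasurableSet ((s : Set ℕ).pi B) := .pi s.countable_toSet fun i _ => hBm i
      rw [Measure.map_apply hseq hs, Measure.restrict_apply (hseq hs), Set.inter_comm,
        Measure.bind_apply hs (iidKernel ℕ E).aemeasurable,
        setLIntegral_map hD ((iidKernel ℕ E).measurable_coe hs) hlam]
      simp_rw [iidKernel, Kernel.coe_mk, Measure.infinitePi_pi _ fun i _ => hBm i]
      rw [← h.measure_inter_finset hη hlam s hBm hD]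
      congr 2
      ext ω
      simp
    · rw [huniv, Measure.map_apply hseq .univ]
      simp
  rw [Measure.compProd_apply_prod hD hC, ← Measure.bind_apply hC (iidKernel ℕ E).aemeasurable,
    ← hrestrict, Measure.map_apply (hlam.prodMk hseq) (hD.prod hC), Measure.map_apply hseq hC,
    Measure.restrict_apply (hseq hC), Set.inter_comm]
  rfl

theorem iidKernel_map_comp {ι κ : Type*} {f : ι → κ} (hf : Function.Injective f)
    (lam : ProbabilityMeasure E) :
    (iidKernel κ E lam).map (fun x i => x (f i)) = iidKernel ι E lam :=
  Measure.map_infinitePi_infinitePi_of_inj hf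

theorem CondIID.map_prodMk (h : CondIID P η lam) (hη : ∀ i, Measurable (η i))
    (hlam : Measurable lam) {ι : Type*} {f : ι → ℕ} (hf : Function.Injective f) :
    P.map (fun ω => (lam ω, fun i => η (f i) ω)) = P.map lam ⊗ₘ iidKernel ι E := by
  have hg : Measurable fun (x : ℕ → E) i => x (f i) := by fun_prop
  have hkernel : iidKernel ι E = (iidKernel ℕ E).map fun x i => x (f i) := by
    ext1 lam
    rw [Kernel.map_apply _ hg, iidKernel_map_comp hf]
  rw [hkernel, Measure.compProd_map hg, ← h.map_prodMk_id hη hlam,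
    Measure.map_map (measurable_id.prodMap hg) (hlam.prodMk (measurable_pi_lambda _ hη))]
  rfl

/-- The proportion of the first `n` terms of the sequence `x` that lie in `A`. -/
noncomputable def frequency {F : Type*} (A : Set F) (n : ℕ) (x : ℕ → F) : ℝ≥0∞ :=
  (∑ k ∈ Finset.range n, A.indicator 1 (x k)) / n

theorem measurable_frequency {A : Set E} (hA : MeasurableSet A) (n : ℕ) :
    Measurable (frequency A n) :=
  (Finset.measurable_fun_sum _ fun k _ =>
    (measurable_one.indicator hA).comp (measurable_pi_apply k)).div_const _

theorem frequency_le_one {F : Type*} (A : Set F) (n : ℕ) (x : ℕ → F) : frequency A n x ≤ 1 := by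
  refine ENNReal.div_le_of_le_mul ?_
  calc ∑ k ∈ Finset.range n, A.indicator 1 (x k) ≤ ∑ _k ∈ Finset.range n, (1 : ℝ≥0∞) :=
        Finset.sum_le_sum fun k _ => Set.indicator_le_self' (fun _ _ => zero_le) _
    _ = 1 * n := by simp

theorem ae_tendsto_frequency_infinitePi (ρ : Measure E) [IsProbabilityMeasure ρ] {A : Set E}
    (hA : MeasurableSet A) :
    ∀ᵐ x ∂Measure.infinitePi fun _ : ℕ => ρ,
      Tendsto (fun n => frequency A n x) atTop (𝓝 (ρ A)) := by
  have hind : Measurable (A.indicator (1 : E → ℝ)) := measurable_one.indicator hA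
  have hlaw (k : ℕ) : IdentDistrib (fun x : ℕ → E => A.indicator (1 : E → ℝ) (x k))
      (A.indicator 1) (Measure.infinitePi fun _ => ρ) ρ :=
    IdentDistrib.comp (f := fun x : ℕ → E => x k) (g := id)
      ⟨(measurable_pi_apply k).aemeasurable, aemeasurable_id,
        (measurePreserving_eval_infinitePi _ k).map_eq.trans Measure.map_id.symm⟩ hind
  have hlln := strong_law_ae_real (μ := Measure.infinitePi fun _ : ℕ => ρ)
    (fun k x => A.indicator (1 : E → ℝ) (x k))
    ((hlaw 0).integrable_iff.2 ((integrable_const 1).indicator hA))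
    (fun i j hij => (iIndepFun_infinitePi (P := fun _ => ρ) fun _ => hind).indepFun hij)
    fun k => (hlaw k).trans (hlaw 0).symm
  rw [(hlaw 0).integral_eq, integral_indicator_one hA] at hlln
  filter_upwards [hlln] with x hx
  have := ENNReal.tendsto_ofReal hx
  rw [ofReal_measureReal] at this
  refine this.congr' ((eventually_gt_atTop 0).mono fun n hn => ?_)
  rw [ENNReal.ofReal_div_of_pos (by exact_mod_cast hn),
    ENNReal.ofReal_sum_of_nonneg fun k _ =>
      Set.indicator_nonneg (s := A) (f := 1) (fun _ _ => zero_le_one) (x k),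
    ENNReal.ofReal_natCast]
  simp only [frequency]
  congr with k
  by_cases hk : x k ∈ A <;> simp [hk]

theorem CondIID.ae_tendsto_frequency (h : CondIID P η lam) (hη : ∀ i, Measurable (η i))
    (hlam : Measurable lam) {ι : Type*} {f : ℕ × ι → ℕ} (hf : Function.Injective f)
    {A : Set (ι → E)} (hA : MeasurableSet A) :
    ∀ᵐ ω ∂P, Tendsto (fun n => frequency A n fun k i => η (f (k, i)) ω) atTop
      (𝓝 (iidKernel ι E (lam ω) A)) := by
  let block (x : ℕ × ι → E) (k : ℕ) (i : ι) : E := x (k, i)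
  have hblock : Measurable block := (MeasurableEquiv.curry ℕ ι E).measurable
  have hset : MeasurableSet {z : ProbabilityMeasure E × (ℕ × ι → E) |
      Tendsto (fun n => frequency A n (block z.2)) atTop (𝓝 (iidKernel ι E z.1 A))} :=
    measurableSet_tendsto_fun
      (fun n => (measurable_frequency hA n).comp (hblock.comp measurable_snd))
      (((iidKernel ι E).measurable_coe hA).comp measurable_fst)
  have hX : Measurable fun ω => (lam ω, fun p => η (f p) ω) :=
    hlam.prodMk (measurable_pi_lambda _ fun p => hη (f p))
  refine (ae_map_iff hX.aemeasurable hset).1 ?_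
  rw [h.map_prodMk hη hlam hf]
  refine Measure.ae_compProd_of_ae_ae hset (Eventually.of_forall fun ρ => ?_)
  have hlln := ae_tendsto_frequency_infinitePi (iidKernel ι E ρ) hA
  have hcurry : (iidKernel (ℕ × ι) E ρ).map block =
      Measure.infinitePi fun _ : ℕ => iidKernel ι E ρ :=
    Measure.infinitePi_map_curry (ι := ℕ) (κ := ι) fun _ _ => (ρ : Measure E)
  rw [← hcurry] at hlln
  exact ae_of_ae_map hblock.aemeasurable hlln

end CondIID

/-! ### Rows of a row exchangeable array -/

section Rows

open Filter Topology

theorem lintegral_prod_frequency {Ω F : Type*} [MeasurableSpace Ω] [MeasurableSpace F]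
    {P : Measure Ω} {m : ℕ} {A : Fin m → Set F} (hA : ∀ i, MeasurableSet (A i))
    {Z : Fin m → ℕ → Ω → F} (hZ : ∀ i k, Measurable (Z i k)) {p : ℝ≥0∞}
    (hp : ∀ c : Fin m → ℕ, P (⋂ i, Z i (c i) ⁻¹' A i) = p) {n : ℕ} (hn : n ≠ 0) :
    ∫⁻ ω, ∏ i, frequency (A i) n (fun k => Z i k ω) ∂P = p := by
  have hind (i : Fin m) (k : ℕ) : Measurable fun ω => (A i).indicator (1 : F → ℝ≥0∞) (Z i k ω) :=
    (measurable_one.indicator (hA i)).comp (hZ i k)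
  have hterm (c : Fin m → ℕ) : ∫⁻ ω, ∏ i, (A i).indicator 1 (Z i (c i) ω) ∂P = p := by
    rw [← hp c, ← lintegral_indicator_one (.iInter fun i => hZ i (c i) (hA i))]
    refine lintegral_congr fun ω => ?_
    classical
    simp [Set.indicator_apply, Finset.prod_ite_zero]
  have hexpand (ω : Ω) : ∏ i, frequency (A i) n (fun k => Z i k ω) =
      ((n : ℝ≥0∞) ^ m)⁻¹ * ∑ c ∈ Fintype.piFinset fun _ : Fin m => Finset.range n,
        ∏ i, (A i).indicator 1 (Z i (c i) ω) := by
    simp only [frequency, div_eq_mul_inv, Finset.prod_mul_distrib, Finset.prod_univ_sum,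
      Finset.prod_const, Finset.card_univ, Fintype.card_fin, ENNReal.inv_pow, mul_comm]
  have hmeas (c : Fin m → ℕ) : Measurable fun ω =>
      ∏ i, (A i).indicator (1 : F → ℝ≥0∞) (Z i (c i) ω) :=
    Finset.measurable_fun_prod _ fun i _ => hind i (c i)
  simp_rw [hexpand]
  rw [lintegral_const_mul _ (Finset.measurable_fun_sum _ fun c _ => hmeas c),
    lintegral_finsetSum _ fun c _ => hmeas c]
  simp_rw [hterm]
  rw [Finset.sum_const, Fintype.card_piFinset_const, Finset.card_range, nsmul_eq_mul, ← mul_assoc,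
    Nat.cast_pow, ENNReal.inv_mul_cancel (pow_ne_zero _ (by exact_mod_cast hn)) (by simp), one_mul]

variable {Ω S : Type*} [MeasurableSpace Ω] [MeasurableSpace S] {P : Measure Ω}
  [IsProbabilityMeasure P] {μ : ℕ → Ω → ProbabilityMeasure S} {ξ : ℕ → ℕ → Ω → S}

theorem CondIID.ae_tendsto_frequency_apply {η : ℕ → Ω → S} {lam : Ω → ProbabilityMeasure S}
    (h : CondIID P η lam) (hη : ∀ i, Measurable (η i)) (hlam : Measurable lam) {f : ℕ → ℕ}
    (hf : Function.Injective f) {B : Set S} (hB : MeasurableSet B) :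
    ∀ᵐ ω ∂P, Tendsto (fun n => frequency B n fun k => η (f k) ω) atTop
      (𝓝 ((lam ω : Measure S) B)) := by
  filter_upwards [h.ae_tendsto_frequency hη hlam (hf.comp Prod.fst_injective)
    (measurable_pi_apply () hB)] with ω hω
  have hcoord : iidKernel Unit S (lam ω) (Function.eval () ⁻¹' B) = (lam ω : Measure S) B :=
    (measurePreserving_eval_infinitePi _ ()).measure_preimage hB.nullMeasurableSet
  exact hcoord ▸ hω

/- The empirical frequencies in row `i` converge to `μ i` whatever the order of its entries, so an
event about `μ` is, up to null sets, one and the same event about every row permutation of `ξ`. -/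
theorem exists_measurableSet_ae_eq_rowDist (hξ : ∀ i j, Measurable (ξ i j))
    (hμ : ∀ i, Measurable (μ i)) (hiid : ∀ i, CondIID P (ξ i) (μ i))
    {D : Set (ℕ → ProbabilityMeasure S)} (hD : MeasurableSet D) :
    ∃ C : Set (ℕ → ℕ → S), MeasurableSet C ∧ ∀ τ : ℕ → Equiv.Perm ℕ,
      (fun ω i j => ξ i (τ i j) ω) ⁻¹' C =ᵐ[P] (fun ω i => μ i ω) ⁻¹' D := by
  let m' : MeasurableSpace (ℕ → ProbabilityMeasure S) :=
    { MeasurableSet' := fun D => ∃ C : Set (ℕ → ℕ → S), MeasurableSet C ∧ ∀ τ : ℕ → Equiv.Perm ℕ,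
        (fun ω i j => ξ i (τ i j) ω) ⁻¹' C =ᵐ[P] (fun ω i => μ i ω) ⁻¹' D
      measurableSet_empty := ⟨∅, .empty, fun _ => .rfl⟩
      measurableSet_compl := fun _ ⟨C, hC, h⟩ => ⟨Cᶜ, hC.compl, fun τ => (h τ).compl⟩
      measurableSet_iUnion := fun D h => by
        choose C hC h using h
        refine ⟨⋃ k, C k, .iUnion hC, fun τ => ?_⟩
        simp only [Set.preimage_iUnion]
        exact Filter.EventuallyEq.countable_iUnion fun k => h k τ }
  suffices MeasurableSpace.pi ≤ m' from this D hD
  refine iSup_le fun i => Measurable.comap_le (Measurable.subtype_mk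
    (Measure.measurable_of_measurable_coe _ fun B hB U hU => ?_))
  have hlim : Measurable fun x : ℕ → ℕ → S => limsup (fun n => frequency B n (x i)) atTop :=
    .limsup fun n => (measurable_frequency hB n).comp (measurable_pi_apply i)
  refine ⟨_, hlim hU, fun τ => ?_⟩
  filter_upwards [(hiid i).ae_tendsto_frequency_apply (hξ i) (hμ i) (τ i).injective hB] with ω hω
  exact congrArg (· ∈ U) hω.limsup_eq |>.to_iff.eq

theorem RowExchangeable.map_perm_prodMk (hex : RowExchangeable P ξ)
    (hξ : ∀ i j, Measurable (ξ i j)) (hμ : ∀ i, Measurable (μ i))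
    (hiid : ∀ i, CondIID P (ξ i) (μ i)) (τ : ℕ → Equiv.Perm ℕ) :
    P.map (fun ω => (fun i j => ξ i (τ i j) ω, fun i => μ i ω)) =
      P.map (fun ω => (fun i j => ξ i j ω, fun i => μ i ω)) := by
  have hrow (τ : ℕ → Equiv.Perm ℕ) : Measurable fun ω i j => ξ i (τ i j) ω :=
    measurable_pi_lambda _ fun i => measurable_pi_lambda _ fun j => hξ i (τ i j)
  have hdist : Measurable fun ω i => μ i ω := measurable_pi_lambda _ hμ
  have := Measure.isProbabilityMeasure_map (μ := P) ((hrow τ).prodMk hdist).aemeasurable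
  refine Measure.ext_prod fun {C D} hC hD => ?_
  obtain ⟨C', hC', h⟩ := exists_measurableSet_ae_eq_rowDist hξ hμ hiid hD
  have hevent (τ : ℕ → Equiv.Perm ℕ) :
      P.map (fun ω => (fun i j => ξ i (τ i j) ω, fun i => μ i ω)) (C ×ˢ D) =
        P.map (fun ω i j => ξ i (τ i j) ω) (C ∩ C') := by
    rw [Measure.map_apply ((hrow τ).prodMk hdist) (hC.prod hD),
      Measure.map_apply (hrow τ) (hC.inter hC')]
    exact measure_congr ((ae_eq_refl _).inter (h τ).symm)
  have hone := hevent fun _ => 1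
  simp only [Equiv.Perm.one_apply] at hone
  rw [hevent τ, hone]
  exact congrArg (· (C ∩ C')) (hex 1 τ)

theorem RowExchangeable.map_embedding_prodMk (hex : RowExchangeable P ξ)
    (hξ : ∀ i j, Measurable (ξ i j)) (hμ : ∀ i, Measurable (μ i))
    (hiid : ∀ i, CondIID P (ξ i) (μ i)) {N : ℕ} (g : ℕ → Fin N ↪ ℕ) :
    P.map (fun ω => (fun i j => ξ i (g i j) ω, fun i => μ i ω)) =
      P.map (fun ω => (fun i => rowSample ξ N i ω, fun i => μ i ω)) := by
  have hτ (i : ℕ) : ∃ τ : Equiv.Perm ℕ, ∀ j : Fin N, τ j = g i j := by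
    obtain ⟨τ, hτ⟩ := (Equiv.Perm.isMultiplyPretransitive ℕ N).exists_smul_eq
      Fin.valEmbedding (g i)
    exact ⟨τ, fun j => DFunLike.congr_fun hτ j⟩
  choose τ hτ using hτ
  have hdist : Measurable fun ω i => μ i ω := measurable_pi_lambda _ hμ
  have hrestrict : Measurable fun z : (ℕ → ℕ → S) × (ℕ → ProbabilityMeasure S) =>
      (fun (i : ℕ) (j : Fin N) => z.1 i j, z.2) := by fun_prop
  have hrow (τ : ℕ → Equiv.Perm ℕ) : Measurable fun ω i j => ξ i (τ i j) ω :=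
    measurable_pi_lambda _ fun i => measurable_pi_lambda _ fun j => hξ i (τ i j)
  have h := congrArg (Measure.map fun z : (ℕ → ℕ → S) × (ℕ → ProbabilityMeasure S) =>
      (fun (i : ℕ) (j : Fin N) => z.1 i j, z.2)) (hex.map_perm_prodMk hξ hμ hiid τ)
  rw [Measure.map_map hrestrict ((hrow τ).prodMk hdist),
    Measure.map_map hrestrict (.prodMk (by fun_prop) hdist)] at h
  simp only [Function.comp_def, hτ] at h
  exact h

theorem RowExchangeable.measure_inter_embedding (hex : RowExchangeable P ξ)
    (hξ : ∀ i j, Measurable (ξ i j)) (hμ : ∀ i, Measurable (μ i))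
    (hiid : ∀ i, CondIID P (ξ i) (μ i)) {N m : ℕ} {D : Set (ℕ → ProbabilityMeasure S)}
    (hD : MeasurableSet D) {A : Fin m → Set (Fin N → S)} (hA : ∀ i, MeasurableSet (A i))
    (g : Fin m → Fin N ↪ ℕ) :
    P ((fun ω i => μ i ω) ⁻¹' D ∩ ⋂ i : Fin m, (fun ω j => ξ i (g i j) ω) ⁻¹' A i) =
      P ((fun ω i => μ i ω) ⁻¹' D ∩ ⋂ i : Fin m, rowSample ξ N i ⁻¹' A i) := by
  let g' : ℕ → Fin N ↪ ℕ := Function.extend Fin.val g fun _ => Fin.valEmbedding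
  have hC : MeasurableSet ({x : ℕ → Fin N → S | ∀ i : Fin m, x i ∈ A i} ×ˢ D) := by
    refine .prod ?_ hD
    simp only [Set.ofPred_forall]
    exact .iInter fun i => measurable_pi_apply (i : ℕ) (hA i)
  have hdist : Measurable fun ω i => μ i ω := measurable_pi_lambda _ hμ
  have h := congrArg (· ({x : ℕ → Fin N → S | ∀ i : Fin m, x i ∈ A i} ×ˢ D))
    (hex.map_embedding_prodMk hξ hμ hiid g')
  rw [Measure.map_apply (.prodMk (by fun_prop) hdist) hC,
    Measure.map_apply (.prodMk (by unfold rowSample; fun_prop) hdist) hC] at h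
  convert h using 2
  · ext ω
    simp [g', Fin.val_injective.extend_apply, and_comm]
  · ext ω
    simp [and_comm]

theorem RowExchangeable.measure_rowSamples (hex : RowExchangeable P ξ)
    (hξ : ∀ i j, Measurable (ξ i j)) (hμ : ∀ i, Measurable (μ i))
    (hiid : ∀ i, CondIID P (ξ i) (μ i)) {N m : ℕ} {D : Set (ℕ → ProbabilityMeasure S)}
    (hD : MeasurableSet D) {A : Fin m → Set (Fin N → S)} (hA : ∀ i, MeasurableSet (A i)) :
    P ((fun ω i => μ i ω) ⁻¹' D ∩ ⋂ i : Fin m, rowSample ξ N i ⁻¹' A i) =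
      ∫⁻ ω in (fun ω i => μ i ω) ⁻¹' D, ∏ i : Fin m, iidKernel (Fin N) S (μ i ω) (A i) ∂P := by
  obtain ⟨e, he⟩ := exists_injective_nat (ℕ × Fin N)
  let block (i : Fin m) (k : ℕ) (ω : Ω) (j : Fin N) : S := ξ i (e (k, j)) ω
  have hblock (i : Fin m) (k : ℕ) : Measurable (block i k) :=
    measurable_pi_lambda _ fun j => hξ i _
  have hshift (c : Fin m → ℕ) :
      P.restrict ((fun ω i => μ i ω) ⁻¹' D) (⋂ i, block i (c i) ⁻¹' A i) =
        P ((fun ω i => μ i ω) ⁻¹' D ∩ ⋂ i : Fin m, rowSample ξ N i ⁻¹' A i) := by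
    rw [Measure.restrict_apply (.iInter fun i => hblock i _ (hA i)), Set.inter_comm]
    exact hex.measure_inter_embedding hξ hμ hiid hD hA fun i =>
      ⟨fun j => e (c i, j), he.comp (Prod.mk_right_injective (c i))⟩
  have hlim : ∀ᵐ ω ∂P.restrict ((fun ω i => μ i ω) ⁻¹' D),
      Tendsto (fun n => ∏ i, frequency (A i) n fun k => block i k ω) atTop
        (𝓝 (∏ i : Fin m, iidKernel (Fin N) S (μ i ω) (A i))) := by
    refine ae_restrict_of_ae ?_
    filter_upwards [ae_all_iff.2 fun i : Fin m =>
      (hiid i).ae_tendsto_frequency (hξ i) (hμ i) he (hA i)] with ω hω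
    exact ENNReal.tendsto_finsetProd_of_ne_top _ (fun i _ => hω i) fun i _ => measure_ne_top _ _
  have hconv := tendsto_lintegral_of_dominated_convergence (fun _ => 1)
    (fun n => Finset.measurable_fun_prod Finset.univ fun i _ =>
      (measurable_frequency (hA i) n).comp (measurable_pi_lambda _ fun k => hblock i k))
    (fun n => ae_of_all _ fun ω => Finset.prod_le_one' fun i _ => frequency_le_one _ _ _)
    (by simp) hlim
  refine tendsto_nhds_unique (tendsto_const_nhds.congr' ?_) hconv
  filter_upwards [eventually_ne_atTop 0] with n hn
  exact (lintegral_prod_frequency hA hblock hshift hn).symm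

end Rows

/-! ### The Pólya urn -/

section Predictive

variable {E : Type*} [MeasurableSpace E]

/-- The Pólya urn with parameter `α`: the law of the next draw from a Dirichlet process with
parameter `α`, given the first `m` draws. -/
noncomputable def predictiveKernel (α : Measure E) (m : ℕ) : Kernel (Fin m → E) E where
  toFun x := (α Set.univ + m)⁻¹ • (α + ∑ i, Measure.dirac (x i))
  measurable' := Measure.measurable_of_measurable_coe _ fun D hD => by
    simp only [Measure.smul_apply, Measure.add_apply, Measure.finsetSum_apply, smul_eq_mul]
    exact (((Finset.measurable_fun_sum _ fun i _ =>
      (Measure.measurable_coe hD).comp (Measure.measurable_dirac.comp (measurable_pi_apply i)))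
      ).const_add _).const_mul _

variable {α : Measure E}

theorem HasDirichletLaw.posterior_bind_evalKernel (h : HasDirichletLaw α) {m : ℕ} (x : Fin m → E) :
    (h.posterior (Fin m) x).bind (evalKernel E) = predictiveKernel α m x := by
  refine (h.add_sum_dirac x).bind_evalKernel.trans ?_
  simp [predictiveKernel]

theorem HasDirichletLaw.isMarkovKernel_predictiveKernel (h : HasDirichletLaw α) (m : ℕ) :
    IsMarkovKernel (predictiveKernel α m) :=
  ⟨fun x => h.posterior_bind_evalKernel x ▸ inferInstance⟩

theorem HasDirichletLaw.bind_iidKernel_succ (h : HasDirichletLaw α) (m : ℕ) :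
    ((dirichletLaw α).bind (iidKernel (Fin (m + 1)) E)).map
        (fun x => ((fun i : Fin m => x i.castSucc), x (Fin.last m))) =
      (dirichletLaw α).bind (iidKernel (Fin m) E) ⊗ₘ predictiveKernel α m := by
  have := h.isProbabilityMeasure
  have := h.isMarkovKernel_predictiveKernel m
  have hsplit : Measurable fun x : Fin (m + 1) → E =>
      ((fun i : Fin m => x i.castSucc), x (Fin.last m)) := by fun_prop
  refine Measure.ext_of_lintegral _ fun f hf => ?_
  have hmean : Measurable fun q : ProbabilityMeasure E × (Fin m → E) =>
      ∫⁻ y, f (q.2, y) ∂evalKernel E q.1 :=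
    Measurable.lintegral_kernel_prod_right' (κ := (evalKernel E).comap Prod.fst measurable_fst)
      (f := fun q => f (q.1.2, q.2))
      (hf.comp ((measurable_snd.comp measurable_fst).prodMk measurable_snd))
  calc ∫⁻ z, f z ∂((dirichletLaw α).bind (iidKernel (Fin (m + 1)) E)).map _
      = ∫⁻ lam, ∫⁻ x, ∫⁻ y, f (x, y) ∂evalKernel E lam ∂iidKernel (Fin m) E lam
          ∂dirichletLaw α := by
        rw [lintegral_map hf hsplit, Measure.lintegral_bind (iidKernel _ E).aemeasurable
          (f := fun x => f ((fun i : Fin m => x i.castSucc), x (Fin.last m)))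
          (hf.comp hsplit).aemeasurable]
        refine lintegral_congr fun lam => ?_
        rw [lintegral_iidKernel_succ (Fin.last m) lam
          (f := fun x => f ((fun i : Fin m => x i.castSucc), x (Fin.last m))) (hf.comp hsplit)]
        simp only [Fin.insertNth_last', Fin.snoc_castSucc, Fin.snoc_last]
        exact lintegral_lintegral_swap (hf.comp measurable_swap).aemeasurable
    _ = ∫⁻ lam, ∫⁻ x, ∫⁻ y, f (x, y) ∂predictiveKernel α m x ∂iidKernel (Fin m) E lam
          ∂dirichletLaw α := by
        rw [h.lintegral_iidKernel m hmean]
        simp_rw [← h.posterior_bind_evalKernel]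
        refine lintegral_congr fun lam => lintegral_congr fun x => ?_
        exact (Measure.lintegral_bind (evalKernel E).aemeasurable
          (hf.comp measurable_prodMk_left).aemeasurable).symm
    _ = _ := by
        rw [Measure.lintegral_compProd hf, Measure.lintegral_bind (iidKernel _ E).aemeasurable
          hf.lintegral_kernel_prod_right'.aemeasurable]

theorem CondIID.map_prodMk_predictive {Ω : Type*} [MeasurableSpace Ω] {P : Measure Ω}
    [IsProbabilityMeasure P] {η : ℕ → Ω → E} {lam : Ω → ProbabilityMeasure E}
    (hη : CondIID P η lam) (hηm : ∀ i, Measurable (η i)) (hlam : Measurable lam)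
    (h : HasDirichletLaw α) (hlaw : P.map lam = dirichletLaw α) (m : ℕ) :
    P.map (fun ω => ((fun i : Fin m => η i ω), η m ω)) =
      P.map (fun ω (i : Fin m) => η i ω) ⊗ₘ predictiveKernel α m := by
  have := h.isProbabilityMeasure
  have hdraws (n : ℕ) : P.map (fun ω (i : Fin n) => η i ω) =
      (dirichletLaw α).bind (iidKernel (Fin n) E) := by
    rw [← hlaw, ← Measure.snd_compProd, ← hη.map_prodMk hηm hlam Fin.val_injective,
      Measure.snd_map_prodMk hlam]
  have hrow : Measurable fun ω (i : Fin (m + 1)) => η i ω := measurable_pi_lambda _ fun i => hηm i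
  have hsplit : Measurable fun x : Fin (m + 1) → E =>
      ((fun i : Fin m => x i.castSucc), x (Fin.last m)) := by fun_prop
  rw [hdraws m, ← h.bind_iidKernel_succ, ← hdraws (m + 1), Measure.map_map hsplit hrow]
  rfl

end Predictive

/-! ### Bayes' formula for a discrete observation -/

section Bayes

variable {α β γ : Type*} [MeasurableSpace β] [MeasurableSpace γ]

/-- The probability of observing `y` when `X` has distribution `k v`, and the probability of
observing `y` given `X = x` is `L y x`. -/
noncomputable def evidence (k : Kernel β γ) (L : α → γ → ℝ≥0∞) (z : α × β) : ℝ≥0∞ :=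
  ∫⁻ x, L z.1 x ∂k z.2

theorem evidence_le_one {k : Kernel β γ} [IsMarkovKernel k] {L : α → γ → ℝ≥0∞}
    (hL : ∀ y x, L y x ≤ 1) (z : α × β) : evidence k L z ≤ 1 :=
  (lintegral_mono (hL z.1)).trans (by simp)

variable [MeasurableSpace α]

theorem measurable_evidence {k : Kernel β γ} [IsSFiniteKernel k] {L : α → γ → ℝ≥0∞}
    (hL : Measurable (Function.uncurry L)) : Measurable (evidence k L) :=
  Measurable.lintegral_kernel_prod_right' (κ := k.comap Prod.snd measurable_snd)
    (f := fun q : (α × β) × γ => L q.1.1 q.2)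
    (hL.comp ((measurable_fst.comp measurable_fst).prodMk measurable_snd))

/-- Bayes' formula: the law of `X`, with prior law `k v`, after the observation `y`, whose
likelihood is `L y`. It is the prior law where the evidence vanishes. -/
noncomputable def bayesKernel (k : Kernel β γ) [IsSFiniteKernel k] (L : α → γ → ℝ≥0∞) :
    Kernel (α × β) γ :=
  (k.comap Prod.snd measurable_snd).withDensity fun z x =>
    if evidence k L z = 0 then 1 else (evidence k L z)⁻¹ * L z.1 x

section

variable {k : Kernel β γ} [IsSFiniteKernel k] {L : α → γ → ℝ≥0∞}

theorem bayesKernel_apply_eq (hL : Measurable (Function.uncurry L)) (z : α × β) :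
    bayesKernel k L z = if evidence k L z = 0 then k z.2 else
      (evidence k L z)⁻¹ • (k z.2).withDensity (L z.1) := by
  have hdensity : Measurable (Function.uncurry fun (z : α × β) x =>
      if evidence k L z = 0 then 1 else (evidence k L z)⁻¹ * L z.1 x) :=
    .ite ((measurable_evidence hL).comp measurable_fst (measurableSet_singleton 0))
      measurable_const
      (((measurable_evidence hL).comp measurable_fst).inv.mul
        (hL.comp ((measurable_fst.comp measurable_fst).prodMk measurable_snd)))
  rw [bayesKernel, Kernel.withDensity_apply _ hdensity, Kernel.comap_apply]
  split_ifs
  · exact withDensity_one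
  · exact withDensity_smul _ (hL.comp measurable_prodMk_left)

theorem bayesKernel_apply (hL : Measurable (Function.uncurry L)) {z : α × β}
    (hz : evidence k L z ≠ 0) :
    bayesKernel k L z = (evidence k L z)⁻¹ • (k z.2).withDensity (L z.1) := by
  rw [bayesKernel_apply_eq hL, if_neg hz]

end

variable {k : Kernel β γ} [IsMarkovKernel k] {L : α → γ → ℝ≥0∞}

theorem isMarkovKernel_bayesKernel (hL : Measurable (Function.uncurry L))
    (hL_le : ∀ y x, L y x ≤ 1) : IsMarkovKernel (bayesKernel k L) := by
  refine ⟨fun z => ⟨?_⟩⟩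
  by_cases hz : evidence k L z = 0
  · rw [bayesKernel_apply_eq hL, if_pos hz, measure_univ]
  · rw [bayesKernel_apply hL hz, Measure.smul_apply, withDensity_apply _ .univ,
      setLIntegral_univ, smul_eq_mul]
    exact ENNReal.inv_mul_cancel hz ((evidence_le_one hL_le z).trans_lt ENNReal.one_lt_top).ne

theorem evidence_mul_bayesKernel (hL : Measurable (Function.uncurry L))
    (hL_le : ∀ y x, L y x ≤ 1) (z : α × β) {D : Set γ} (hD : MeasurableSet D) :
    evidence k L z * bayesKernel k L z D = ∫⁻ x in D, L z.1 x ∂k z.2 := by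
  by_cases hz : evidence k L z = 0
  · rw [hz, zero_mul]
    exact (le_antisymm (hz ▸ setLIntegral_le_lintegral _ _) zero_le).symm
  · rw [bayesKernel_apply hL hz, Measure.smul_apply, withDensity_apply _ hD, smul_eq_mul,
      ENNReal.mul_inv_cancel_left hz ((evidence_le_one hL_le z).trans_lt ENNReal.one_lt_top).ne]

variable {Ω : Type*} [MeasurableSpace Ω] {P : Measure Ω} {Y : Ω → α} {V : Ω → β} {X : Ω → γ}
  {g : α → β → ℝ≥0∞}

/-- A Bayesian experiment: `X` has conditional law `k` given `V`, and, given `V = v` and `X = x`,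
the value `y` of `Y` has probability `g y v * L y x`. -/
structure IsBayesModel (P : Measure Ω) (Y : Ω → α) (V : Ω → β) (X : Ω → γ) (k : Kernel β γ)
    (g : α → β → ℝ≥0∞) (L : α → γ → ℝ≥0∞) : Prop where
  measurable_observation : Measurable Y
  measurable_past : Measurable V
  measurable_parameter : Measurable X
  map_prodMk : P.map (fun ω => (V ω, X ω)) = P.map V ⊗ₘ k
  measurable_factor : ∀ y, Measurable (g y)
  measurable_likelihood : Measurable (Function.uncurry L)
  likelihood_le_one : ∀ y x, L y x ≤ 1
  measure_inter : ∀ (y : α) (C : Set (β × γ)), MeasurableSet C →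
    P (Y ⁻¹' {y} ∩ (fun ω => (V ω, X ω)) ⁻¹' C) =
      ∫⁻ ω in (fun ω => (V ω, X ω)) ⁻¹' C, g y (V ω) * L y (X ω) ∂P

theorem IsBayesModel.measurable_density (h : IsBayesModel P Y V X k g L) (y : α) :
    Measurable fun v => g y v * evidence k L (y, v) :=
  (h.measurable_factor y).mul
    ((measurable_evidence h.measurable_likelihood).comp measurable_prodMk_left)

variable [IsFiniteMeasure P]

theorem IsBayesModel.measure_observation_inter (h : IsBayesModel P Y V X k g L) (y : α)
    {B : Set β} (hB : MeasurableSet B) {D : Set γ} (hD : MeasurableSet D) :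
    P (Y ⁻¹' {y} ∩ V ⁻¹' B ∩ X ⁻¹' D) =
      ∫⁻ v in B, g y v * evidence k L (y, v) * bayesKernel k L (y, v) D ∂P.map V := by
  have hLy : Measurable (L y) := h.measurable_likelihood.comp measurable_prodMk_left
  have hf : Measurable fun z : β × γ => g y z.1 * L y z.2 :=
    ((h.measurable_factor y).comp measurable_fst).mul (hLy.comp measurable_snd)
  rw [Set.inter_assoc]
  refine (h.measure_inter y _ (hB.prod hD)).trans ?_
  rw [← setLIntegral_map (hB.prod hD) hf (h.measurable_past.prodMk h.measurable_parameter),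
    h.map_prodMk, Measure.setLIntegral_compProd hf hB hD]
  refine lintegral_congr fun v => ?_
  rw [mul_assoc, evidence_mul_bayesKernel h.measurable_likelihood h.likelihood_le_one _ hD,
    ← lintegral_const_mul _ hLy]

theorem IsBayesModel.map_restrict_observation (h : IsBayesModel P Y V X k g L) (y : α) :
    (P.restrict (Y ⁻¹' {y})).map V =
      (P.map V).withDensity fun v => g y v * evidence k L (y, v) := by
  have := isMarkovKernel_bayesKernel (k := k) h.measurable_likelihood h.likelihood_le_one
  ext B hB
  have hinter := h.measure_observation_inter y hB .univ
  simp only [Set.preimage_univ, Set.inter_univ, measure_univ, mul_one] at hinter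
  rw [Measure.map_apply h.measurable_past hB, Measure.restrict_apply (h.measurable_past hB),
    withDensity_apply _ hB, ← hinter, Set.inter_comm]

variable [Countable α] [MeasurableSingletonClass α]

theorem hasCondDistrib_of_countable (hY : Measurable Y) (hV : Measurable V)
    (hX : Measurable X) (k : Kernel (α × β) γ) [IsMarkovKernel k]
    (h : ∀ (y : α) (B : Set β) (D : Set γ), MeasurableSet B → MeasurableSet D →
      P (Y ⁻¹' {y} ∩ V ⁻¹' B ∩ X ⁻¹' D) = ∫⁻ ω in Y ⁻¹' {y} ∩ V ⁻¹' B, k (y, V ω) D ∂P) :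
    HasCondDistrib X (fun ω => (Y ω, V ω)) k P := by
  have hZ : Measurable fun ω => (Y ω, V ω) := hY.prodMk hV
  refine ⟨(hZ.prodMk hX).aemeasurable, Measure.ext_prod₃_iff'.mpr fun {s B D} hs hB hD => ?_⟩
  have hdisj : Pairwise (Function.onFun Disjoint fun y : s => Y ⁻¹' {(y : α)} ∩ V ⁻¹' B) :=
    fun y y' hy => .mono Set.inter_subset_left Set.inter_subset_left
      (.preimage _ (Set.disjoint_singleton.2 (Subtype.coe_injective.ne hy)))
  have hmeas (y : s) : MeasurableSet (Y ⁻¹' {(y : α)} ∩ V ⁻¹' B) :=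
    (hY (measurableSet_singleton _)).inter (hV hB)
  have hsplit : (fun ω => (Y ω, V ω)) ⁻¹' (s ×ˢ B) = ⋃ y : s, Y ⁻¹' {(y : α)} ∩ V ⁻¹' B := by
    ext ω
    simp
  have hsplit' : (fun ω => ((Y ω, V ω), X ω)) ⁻¹' ((s ×ˢ B) ×ˢ D) =
      ⋃ y : s, Y ⁻¹' {(y : α)} ∩ V ⁻¹' B ∩ X ⁻¹' D := by
    rw [← Set.iUnion_inter, ← hsplit]
    rfl
  rw [Measure.map_apply (hZ.prodMk hX) ((hs.prod hB).prod hD),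
    Measure.compProd_apply_prod (hs.prod hB) hD,
    setLIntegral_map (hs.prod hB) (k.measurable_coe hD) hZ, hsplit, hsplit',
    lintegral_iUnion hmeas hdisj, measure_iUnion
      (fun y y' hy => (hdisj hy).mono Set.inter_subset_left Set.inter_subset_left)
      fun y => (hmeas y).inter (hX hD)]
  refine tsum_congr fun y => ?_
  rw [h y B D hB hD]
  refine setLIntegral_congr_fun (hmeas y) fun ω hω => ?_
  rw [show Y ω = y from hω.1]

theorem IsBayesModel.hasCondDistrib_bayesKernel (h : IsBayesModel P Y V X k g L) :
    HasCondDistrib X (fun ω => (Y ω, V ω)) (bayesKernel k L) P := by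
  have := isMarkovKernel_bayesKernel (k := k) h.measurable_likelihood h.likelihood_le_one
  have hV := h.measurable_past
  refine hasCondDistrib_of_countable h.measurable_observation hV h.measurable_parameter _
    fun y B D hB hD => ?_
  have hbayes : Measurable fun v => bayesKernel k L (y, v) D :=
    ((bayesKernel k L).measurable_coe hD).comp measurable_prodMk_left
  rw [h.measure_observation_inter y hB hD, Set.inter_comm, ← Measure.restrict_restrict (hV hB),
    ← setLIntegral_map hB hbayes hV, h.map_restrict_observation,
    setLIntegral_withDensity_eq_setLIntegral_mul _ (h.measurable_density y) hbayes hB]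
  rfl

theorem IsBayesModel.ae_evidence_ne_zero (h : IsBayesModel P Y V X k g L) :
    ∀ᵐ z ∂P.map fun ω => (Y ω, V ω), evidence k L z ≠ 0 := by
  have hY := h.measurable_observation
  have hV := h.measurable_past
  have hcell (y : α) : ∀ᵐ ω ∂P, Y ω = y → evidence k L (y, V ω) ≠ 0 := by
    refine (ae_restrict_iff' (hY (measurableSet_singleton y))).1
      (ae_of_ae_map (p := fun v => evidence k L (y, v) ≠ 0) hV.aemeasurable ?_)
    rw [h.map_restrict_observation, ae_withDensity_iff (h.measurable_density y)]
    exact ae_of_all _ fun v => right_ne_zero_of_mul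
  refine (ae_map_iff (hY.prodMk hV).aemeasurable
    (measurable_evidence h.measurable_likelihood (measurableSet_singleton 0)).compl).2 ?_
  filter_upwards [ae_all_iff.2 hcell] with ω hω using hω _ rfl

end Bayes

/-! ### The law of a single row -/

theorem measure_smul_cond_bind {α β : Type*} [MeasurableSpace α] [MeasurableSpace β]
    {μ : Measure α} [IsFiniteMeasure μ] (A : Set α) (k : Kernel α β) :
    μ A • (μ[|A]).bind k = (μ.restrict A).bind k := by
  rw [← Measure.bind_smul, ProbabilityTheory.cond, smul_smul]
  rcases eq_or_ne (μ A) 0 with hA | hA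
  · rw [hA, zero_mul, zero_smul, Measure.restrict_eq_zero.2 hA]
  · rw [ENNReal.mul_inv_cancel hA (measure_ne_top _ _), one_smul]

section SingleRow

variable {S : Type*} [MeasurableSpace S] {m N : ℕ} {κ ε : ℝ≥0} {ϱ : ProbabilityMeasure S}
  {A : Set (Fin N → S)}

theorem rowWeight_castSucc (ϱN : Measure (Fin N → S)) (ν : Fin m → ProbabilityMeasure S)
    (i : Fin m) : rowWeight κ ϱN A ν i.castSucc = iidKernel (Fin N) S (ν i) A := by
  rw [rowWeight, Fin.snoc_castSucc, iidKernel_apply]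

theorem rowWeight_last (ϱN : Measure (Fin N → S)) (ν : Fin m → ProbabilityMeasure S) :
    rowWeight κ ϱN A ν (Fin.last m) = κ * ϱN A := by
  rw [rowWeight, Fin.snoc_last]

theorem rowWeight_ne_top {ϱN : Measure (Fin N → S)} [IsFiniteMeasure ϱN]
    (ν : Fin m → ProbabilityMeasure S) (i : Fin (m + 1)) : rowWeight κ ϱN A ν i ≠ ∞ := by
  cases i using Fin.lastCases with
  | last => exact rowWeight_last ϱN ν ▸ ENNReal.mul_ne_top ENNReal.coe_ne_top (measure_ne_top _ _)
  | cast i => exact rowWeight_castSucc ϱN ν i ▸ measure_ne_top _ _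

theorem sum_rowWeight_smul_singleRowLaw {ϱN : Measure (Fin N → S)} [IsFiniteMeasure ϱN]
    (h : HasDirichletLaw (ε • (ϱ : Measure S))) (ν : Fin m → ProbabilityMeasure S) :
    (∑ i, rowWeight κ ϱN A ν i) • singleRowLaw κ ε ϱ ϱN A ν =
      (κ : ℝ≥0∞) • (ϱN.restrict A).bind (h.posterior (Fin N)) +
        ∑ i, iidKernel (Fin N) S (ν i) A • Measure.dirac (ν i) := by
  have hcancel (i : Fin (m + 1)) : (∑ j, rowWeight κ ϱN A ν j) *
      (rowWeight κ ϱN A ν i / ∑ j, rowWeight κ ϱN A ν j) = rowWeight κ ϱN A ν i :=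
    ENNReal.mul_div_cancel'
      (fun h0 => (Finset.sum_eq_zero_iff.1 h0) i (Finset.mem_univ i))
      fun htop => absurd htop (ENNReal.sum_ne_top.2 fun j _ => rowWeight_ne_top ν j)
  simp only [singleRowLaw, smul_add, Finset.smul_sum, smul_smul, hcancel]
  simp only [rowWeight_castSucc, rowWeight_last, mul_smul, ← measure_smul_cond_bind A]
  rfl

theorem predictiveKernel_smul_dirichletLaw
    [IsProbabilityMeasure (dirichletLaw (ε • (ϱ : Measure S)))] (ν : Fin m → ProbabilityMeasure S) :
    predictiveKernel (κ • dirichletLaw (ε • (ϱ : Measure S))) m ν =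
      ((κ : ℝ≥0∞) + m)⁻¹ •
        ((κ : ℝ≥0∞) • dirichletLaw (ε • (ϱ : Measure S)) + ∑ i, Measure.dirac (ν i)) := by
  have huniv : (κ • dirichletLaw (ε • (ϱ : Measure S))) Set.univ = κ := by
    rw [Measure.smul_apply, measure_univ, ENNReal.smul_def, smul_eq_mul, mul_one]
  simp only [predictiveKernel, huniv]
  rfl

variable {ϱN : Measure (Fin N → S)}

theorem withDensity_predictiveKernel (h : HasDirichletLaw (ε • (ϱ : Measure S)))
    (hϱN : ϱN = (dirichletLaw (ε • (ϱ : Measure S))).bind (iidKernel (Fin N) S))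
    (hA : MeasurableSet A) (ν : Fin m → ProbabilityMeasure S) :
    (predictiveKernel (κ • dirichletLaw (ε • (ϱ : Measure S))) m ν).withDensity
        (fun lam => iidKernel (Fin N) S lam A) =
      (((κ : ℝ≥0∞) + m)⁻¹ * ∑ i, rowWeight κ ϱN A ν i) • singleRowLaw κ ε ϱ ϱN A ν := by
  have := h.isProbabilityMeasure
  have : IsFiniteMeasure ϱN := hϱN ▸ inferInstance
  have hlik := (iidKernel (Fin N) S).measurable_coe hA
  rw [mul_smul, sum_rowWeight_smul_singleRowLaw h, hϱN, ← h.withDensity_iidKernel hA,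
    predictiveKernel_smul_dirichletLaw, withDensity_smul_measure, withDensity_add_measure,
    withDensity_smul_measure, ← Measure.sum_fintype, withDensity_sum, Measure.sum_fintype]
  simp only [dirac_withDensity' hlik]

theorem lintegral_predictiveKernel (h : HasDirichletLaw (ε • (ϱ : Measure S)))
    (hϱN : ϱN = (dirichletLaw (ε • (ϱ : Measure S))).bind (iidKernel (Fin N) S))
    (hA : MeasurableSet A) (ν : Fin m → ProbabilityMeasure S) :
    ∫⁻ lam, iidKernel (Fin N) S lam A
        ∂predictiveKernel (κ • dirichletLaw (ε • (ϱ : Measure S))) m ν =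
      ((κ : ℝ≥0∞) + m)⁻¹ * ∑ i, rowWeight κ ϱN A ν i := by
  have := h.isProbabilityMeasure
  have hlik := (iidKernel (Fin N) S).measurable_coe hA
  rw [predictiveKernel_smul_dirichletLaw, lintegral_smul_measure, lintegral_add_measure,
    lintegral_smul_measure, lintegral_finsetSum_measure, Fin.sum_univ_castSucc, rowWeight_last,
    hϱN, Measure.bind_apply hA (iidKernel _ S).aemeasurable, add_comm (∑ i : Fin m, _)]
  simp only [lintegral_dirac' _ hlik, rowWeight_castSucc, smul_eq_mul]

end SingleRow

/-! ### The conditional law of a row -/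

section Application

theorem preimage_observation {Ω S T : Type*} {m N : ℕ} (ξ : ℕ → ℕ → Ω → S)
    (φ : Fin m → (Fin N → S) → T) (y : Fin m → T) :
    (fun ω i => φ i (rowSample ξ N i ω)) ⁻¹' {y} =
      ⋂ i : Fin m, rowSample ξ N i ⁻¹' (φ i ⁻¹' {y i}) := by
  ext ω
  simp [funext_iff]

variable {Ω S T : Type*} [MeasurableSpace Ω] [MeasurableSpace S]

/-- The probability of the observation `t` of a row whose entries are i.i.d. with distribution
`lam`, when a row `x` is observed through `ψ x`. -/
noncomputable def rowLikelihood {N : ℕ} (ψ : (Fin N → S) → T) (t : T) (lam : ProbabilityMeasure S) :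
    ℝ≥0∞ :=
  iidKernel (Fin N) S lam (ψ ⁻¹' {t})

variable {P : Measure Ω} [IsProbabilityMeasure P] {κ ε : ℝ≥0} {ϱ : ProbabilityMeasure S}
  {ϖ : Ω → ProbabilityMeasure (ProbabilityMeasure S)} {μ : ℕ → Ω → ProbabilityMeasure S}
  {ξ : ℕ → ℕ → Ω → S} {N m : ℕ}

theorem IsNDPArray.hasDirichletLaw_row (hξ : IsNDPArray P κ ε ϱ ϖ μ ξ) :
    HasDirichletLaw (ε • (ϱ : Measure S)) := by
  have := Measure.isProbabilityMeasure_map (μ := P) hξ.measurable_generator.aemeasurable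
  refine hasDirichletLaw_of_ne_zero fun h0 => ?_
  rw [hξ.law_generator, h0, smul_zero] at this
  exact (hasDirichletLaw_of_ne_zero (IsProbabilityMeasure.ne_zero
    (dirichletLaw (0 : Measure (ProbabilityMeasure S))))).ne_zero rfl

theorem IsNDPArray.hasDirichletLaw_generator (hξ : IsNDPArray P κ ε ϱ ϖ μ ξ) :
    HasDirichletLaw (κ • dirichletLaw (ε • (ϱ : Measure S))) := by
  have := Measure.isProbabilityMeasure_map (μ := P) hξ.measurable_generator.aemeasurable
  have := hξ.hasDirichletLaw_row.isProbabilityMeasure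
  exact hasDirichletLaw_of_ne_zero (hξ.law_generator ▸ IsProbabilityMeasure.ne_zero (P.map ϖ))

theorem IsNDPArray.map_rowDist (hξ : IsNDPArray P κ ε ϱ ϖ μ ξ) (m : ℕ) :
    P.map (μ m) = dirichletLaw (ε • (ϱ : Measure S)) := by
  have h := hξ.hasDirichletLaw_generator
  have := hξ.hasDirichletLaw_row.isProbabilityMeasure
  rw [hξ.rowDist_iid.map_eq_bind hξ.measurable_rowDist hξ.measurable_generator, hξ.law_generator,
    h.bind_evalKernel]
  have hκ : κ ≠ 0 := fun h0 => h.ne_zero (by rw [h0, zero_smul])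
  ext D
  simp only [Measure.smul_apply, measure_univ, ENNReal.smul_def, smul_eq_mul, mul_one]
  exact ENNReal.inv_mul_cancel_left (by simpa using hκ) ENNReal.coe_ne_top

theorem IsNDPArray.map_rowSample (hξ : IsNDPArray P κ ε ϱ ϖ μ ξ) (N m : ℕ) :
    P.map (rowSample ξ N m) = (dirichletLaw (ε • (ϱ : Measure S))).bind (iidKernel (Fin N) S) := by
  have hμ := hξ.measurable_rowDist m
  have := Measure.isProbabilityMeasure_map (μ := P) hμ.aemeasurable
  rw [← hξ.map_rowDist m, ← Measure.snd_compProd,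
    ← (hξ.row_iid m).map_prodMk (hξ.measurable_array m) hμ Fin.val_injective,
    Measure.snd_map_prodMk hμ]
  rfl

variable [MeasurableSpace T] [MeasurableSingletonClass T]

theorem measurable_rowLikelihood {ψ : (Fin N → S) → T} (hψ : Measurable ψ) (t : T) :
    Measurable (rowLikelihood ψ t) :=
  (iidKernel (Fin N) S).measurable_coe (hψ (measurableSet_singleton t))

theorem IsNDPArray.evidence_rowLikelihood (hξ : IsNDPArray P κ ε ϱ ϖ μ ξ)
    {ψ : (Fin N → S) → T} (hψ : Measurable ψ)
    (z : (Fin (m + 1) → T) × (Fin m → ProbabilityMeasure S)) :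
    evidence (predictiveKernel (κ • dirichletLaw (ε • (ϱ : Measure S))) m)
        (fun y => rowLikelihood ψ (y (Fin.last m))) z =
      ((κ : ℝ≥0∞) + m)⁻¹ *
        ∑ i, rowWeight κ (P.map (rowSample ξ N m)) (ψ ⁻¹' {z.1 (Fin.last m)}) z.2 i :=
  lintegral_predictiveKernel hξ.hasDirichletLaw_row (hξ.map_rowSample N m)
    (hψ (measurableSet_singleton _)) z.2

variable [Countable T] {φ : Fin (m + 1) → (Fin N → S) → T}

theorem IsNDPArray.isBayesModel (hξ : IsNDPArray P κ ε ϱ ϖ μ ξ) (hφ : ∀ i, Measurable (φ i)) :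
    IsBayesModel P (fun ω i => φ i (rowSample ξ N i ω)) (fun ω (i : Fin m) => μ i ω) (μ m)
      (predictiveKernel (κ • dirichletLaw (ε • (ϱ : Measure S))) m)
      (fun y ν => ∏ i : Fin m, rowLikelihood (φ i.castSucc) (y i.castSucc) (ν i))
      (fun y => rowLikelihood (φ (Fin.last m)) (y (Fin.last m))) where
  measurable_observation := measurable_pi_lambda _ fun i =>
    (hφ i).comp (measurable_pi_lambda _ fun j => hξ.measurable_array i j)
  measurable_past := measurable_pi_lambda _ fun i => hξ.measurable_rowDist i
  measurable_parameter := hξ.measurable_rowDist m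
  map_prodMk := hξ.rowDist_iid.map_prodMk_predictive hξ.measurable_rowDist
    hξ.measurable_generator hξ.hasDirichletLaw_generator hξ.law_generator m
  measurable_factor y := Finset.measurable_fun_prod _ fun i _ =>
    (measurable_rowLikelihood (hφ _) _).comp (measurable_pi_apply i)
  measurable_likelihood := measurable_from_prod_countable_right fun y =>
    measurable_rowLikelihood (hφ _) _
  likelihood_le_one _ _ := prob_le_one
  measure_inter y C hC := by
    let D : Set (ℕ → ProbabilityMeasure S) := (fun ν => ((fun i : Fin m => ν i), ν m)) ⁻¹' C
    have hD : MeasurableSet D := by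
      have : Measurable fun ν : ℕ → ProbabilityMeasure S => ((fun i : Fin m => ν i), ν m) := by
        fun_prop
      exact this hC
    rw [preimage_observation, Set.inter_comm]
    refine (hξ.rowExchangeable.measure_rowSamples hξ.measurable_array hξ.measurable_rowDist
      hξ.row_iid hD fun i => hφ i (measurableSet_singleton _)).trans ?_
    simp only [Fin.prod_univ_castSucc]
    rfl

theorem IsNDPArray.bayesKernel_eq_singleRowLaw (hξ : IsNDPArray P κ ε ϱ ϖ μ ξ)
    [IsMarkovKernel (predictiveKernel (κ • dirichletLaw (ε • (ϱ : Measure S))) m)]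
    {ψ : (Fin N → S) → T} (hψ : Measurable ψ)
    {z : (Fin (m + 1) → T) × (Fin m → ProbabilityMeasure S)}
    (hz : ∑ i, rowWeight κ (P.map (rowSample ξ N m)) (ψ ⁻¹' {z.1 (Fin.last m)}) z.2 i ≠ 0) :
    bayesKernel (predictiveKernel (κ • dirichletLaw (ε • (ϱ : Measure S))) m)
        (fun y => rowLikelihood ψ (y (Fin.last m))) z =
      singleRowLaw κ ε ϱ (P.map (rowSample ξ N m)) (ψ ⁻¹' {z.1 (Fin.last m)}) z.2 := by
  have hA : MeasurableSet (ψ ⁻¹' {z.1 (Fin.last m)}) := hψ (measurableSet_singleton _)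
  have hev := hξ.evidence_rowLikelihood hψ z
  have hev0 : evidence (predictiveKernel (κ • dirichletLaw (ε • (ϱ : Measure S))) m)
      (fun y => rowLikelihood ψ (y (Fin.last m))) z ≠ 0 :=
    hev ▸ mul_ne_zero (ENNReal.inv_ne_zero.2 (by simp)) hz
  have hle := evidence_le_one (k := predictiveKernel (κ • dirichletLaw (ε • (ϱ : Measure S))) m)
    (L := fun y => rowLikelihood ψ (y (Fin.last m))) (fun _ _ => prob_le_one) z
  rw [bayesKernel_apply (measurable_from_prod_countable_right fun y =>
    measurable_rowLikelihood hψ _) hev0]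
  refine (congrArg _ (withDensity_predictiveKernel hξ.hasDirichletLaw_row (hξ.map_rowSample N m) hA
    z.2)).trans ?_
  rw [← hev, smul_smul, ENNReal.inv_mul_cancel hev0 (hle.trans_lt ENNReal.one_lt_top).ne, one_smul]

end Application

theorem countablyGenerated_probabilityMeasure (S : Type*) [MeasurableSpace S]
    [MeasurableSpace.CountablyGenerated S] :
    MeasurableSpace.CountablyGenerated (ProbabilityMeasure S) := by
  set C := generateSetAlgebra (MeasurableSpace.countableGeneratingSet S) with hC
  have hCc : C.Countable :=
    countable_generateSetAlgebra MeasurableSpace.countable_countableGeneratingSet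
  have hCgen : ‹MeasurableSpace S› = MeasurableSpace.generateFrom C := by
    rw [hC, generateFrom_generateSetAlgebra_eq, MeasurableSpace.generateFrom_countableGeneratingSet]
  have hCpi : IsPiSystem C := fun s hs t ht _ => isSetAlgebra_generateSetAlgebra.inter_mem hs ht
  have hCm : ∀ B ∈ C, MeasurableSet B := fun B hB => by
    rw [hCgen]; exact MeasurableSpace.measurableSet_generateFrom hB
  have : Countable C := hCc.to_subtype
  let ev : ProbabilityMeasure S → C → ℝ≥0∞ := fun lam B => (lam : Measure S) B
  have hev : Measurable ev := measurable_pi_lambda _ fun B => measurable_coe_apply (hCm B B.2)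
  have heq : (inferInstance : MeasurableSpace (ProbabilityMeasure S)) =
      MeasurableSpace.comap ev inferInstance := by
    apply le_antisymm
    · have h : @Measurable _ _ (MeasurableSpace.comap ev inferInstance) _
          (Subtype.val : ProbabilityMeasure S → Measure S) := by
        refine @Measurable.measure_of_isPiSystem_of_isProbabilityMeasure _ _
          (MeasurableSpace.comap ev inferInstance) _ Subtype.val
          (fun lam : ProbabilityMeasure S => lam.2) C hCgen hCpi fun B hB => ?_
        exact (measurable_pi_apply (⟨B, hB⟩ : C)).comp (comap_measurable ev)
      exact h.comap_le
    · exact hev.comap_le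
  have := MeasurableSpace.CountablyGenerated.comap (β := C → ℝ≥0∞) ev
  rwa [← heq] at this

end NestedDirichlet

theorem theorem4p3_general {Ω S T : Type*} [MeasurableSpace Ω]
    [MeasurableSpace S] [MeasurableSpace.CountablyGenerated S]
    [Countable T] [MeasurableSpace T] [MeasurableSingletonClass T]
    (P : Measure Ω) [IsProbabilityMeasure P] (κ ε : ℝ≥0) (ϱ : ProbabilityMeasure S)
    (ϖ : Ω → ProbabilityMeasure (ProbabilityMeasure S))
    (μ : ℕ → Ω → ProbabilityMeasure S) (ξ : ℕ → ℕ → Ω → S)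
    (hξ : IsNDPArray P κ ε ϱ ϖ μ ξ)
    (N m : ℕ) (φ : Fin (m + 1) → (Fin N → S) → T) (hφ : ∀ i, Measurable (φ i)) :
    let Y : Ω → Fin (m + 1) → T := fun ω i => φ i (rowSample ξ N i ω)
    let μprev : Ω → Fin m → ProbabilityMeasure S := fun ω i => μ i ω
    let ϱN : Measure (Fin N → S) := P.map (rowSample ξ N m)
    let A : (Fin (m + 1) → T) → Set (Fin N → S) := fun y => φ (Fin.last m) ⁻¹' {y (Fin.last m)}
    (∃ γ : Kernel ((Fin (m + 1) → T) × (Fin m → ProbabilityMeasure S)) (ProbabilityMeasure S),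
      IsMarkovKernel γ ∧ HasCondDistrib (μ m) (fun ω => (Y ω, μprev ω)) γ P ∧
        ∀ y ν, ∑ i, rowWeight κ ϱN (A y) ν i ≠ 0 →
          γ (y, ν) = singleRowLaw κ ε ϱ ϱN (A y) ν) ∧
    (∀ γ : Kernel ((Fin (m + 1) → T) × (Fin m → ProbabilityMeasure S)) (ProbabilityMeasure S),
      IsMarkovKernel γ → HasCondDistrib (μ m) (fun ω => (Y ω, μprev ω)) γ P →
        ∀ᵐ z ∂(P.map fun ω => (Y ω, μprev ω)),
          ∑ i, rowWeight κ ϱN (A z.1) z.2 i ≠ 0 ∧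
            γ z = singleRowLaw κ ε ϱ ϱN (A z.1) z.2) := by
  intro Y μprev ϱN A
  have hmodel := hξ.isBayesModel hφ
  have := hξ.hasDirichletLaw_generator.isMarkovKernel_predictiveKernel m
  have hbayes := hmodel.hasCondDistrib_bayesKernel
  have hMarkov := isMarkovKernel_bayesKernel
    (k := predictiveKernel (κ • dirichletLaw (ε • (ϱ : Measure S))) m)
    hmodel.measurable_likelihood hmodel.likelihood_le_one
  refine ⟨⟨_, hMarkov, hbayes, fun y ν hq =>
    hξ.bayesKernel_eq_singleRowLaw (z := (y, ν)) (hφ _) hq⟩, fun γ hγ hγc => ?_⟩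
  have := countablyGenerated_probabilityMeasure S
  have := Measure.isProbabilityMeasure_map (μ := P)
    (hmodel.measurable_observation.prodMk hmodel.measurable_past).aemeasurable
  filter_upwards [hmodel.ae_evidence_ne_zero,
    Kernel.ae_eq_of_compProd_eq (hγc.map_eq.symm.trans hbayes.map_eq)] with z hz hγz
  have hq : ∑ i, rowWeight κ ϱN (A z.1) z.2 i ≠ 0 :=
    right_ne_zero_of_mul (hξ.evidence_rowLikelihood (hφ _) z ▸ hz)
  exact ⟨hq, hγz.trans (hξ.bayesKernel_eq_singleRowLaw (hφ _) hq)⟩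

/-- The current row has index `m` and the previous rows are `0, …, m - 1`; `φ i` is the observation
map of row `i`. The first part says that the formula defines, wherever the weights do not all
vanish, a regular conditional distribution of `μ m` given the observations and the previous row
distributions; the second says that every regular conditional distribution is almost everywhere
given by the formula (whose weights almost surely do not all vanish). -/
theorem theorem4p3 {Ω S T : Type*} [MeasurableSpace Ω]
    [MetricSpace S] [CompleteSpace S] [TopologicalSpace.SeparableSpace S]
    [MeasurableSpace S] [BorelSpace S]
    [Countable T] [MeasurableSpace T] [MeasurableSingletonClass T]
    (P : Measure Ω) [IsProbabilityMeasure P]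
    (κ ε : ℝ≥0) (hκ : 0 < κ) (hε : 0 < ε) (ϱ : ProbabilityMeasure S)
    (ϖ : Ω → ProbabilityMeasure (ProbabilityMeasure S))
    (μ : ℕ → Ω → ProbabilityMeasure S) (ξ : ℕ → ℕ → Ω → S)
    (hξ : IsNDPArray P κ ε ϱ ϖ μ ξ)
    (N m : ℕ) (φ : Fin (m + 1) → (Fin N → S) → T) (hφ : ∀ i, Measurable (φ i)) :
    let Y : Ω → Fin (m + 1) → T := fun ω i => φ i (rowSample ξ N i ω)
    let μprev : Ω → Fin m → ProbabilityMeasure S := fun ω i => μ i ω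
    let ϱN : Measure (Fin N → S) := P.map (rowSample ξ N m)
    let A : (Fin (m + 1) → T) → Set (Fin N → S) := fun y => φ (Fin.last m) ⁻¹' {y (Fin.last m)}
    (∃ γ : Kernel ((Fin (m + 1) → T) × (Fin m → ProbabilityMeasure S)) (ProbabilityMeasure S),
      IsMarkovKernel γ ∧ HasCondDistrib (μ m) (fun ω => (Y ω, μprev ω)) γ P ∧
        ∀ y ν, ∑ i, rowWeight κ ϱN (A y) ν i ≠ 0 →
          γ (y, ν) = singleRowLaw κ ε ϱ ϱN (A y) ν) ∧
    (∀ γ : Kernel ((Fin (m + 1) → T) × (Fin m → ProbabilityMeasure S)) (ProbabilityMeasure S),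
      IsMarkovKernel γ → HasCondDistrib (μ m) (fun ω => (Y ω, μprev ω)) γ P →
        ∀ᵐ z ∂(P.map fun ω => (Y ω, μprev ω)),
          ∑ i, rowWeight κ ϱN (A z.1) z.2 i ≠ 0 ∧
            γ z = singleRowLaw κ ε ϱ ϱN (A z.1) z.2) :=
  theorem4p3_general P κ ε ϱ ϖ μ ξ hξ N m φ hφ
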